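/- Let $\Pi\subset\mathbb{R}^4$ be a two-dimensional linear subspace and let $f:\Sigma\to\mathbb{R}^4$ be a smooth immersed surface. For two-dimensional subspaces $V,W\subset\mathbb{R}^4$ the principal angles $0\le\theta_1\le\theta_2\le\pi/2$ are given by $\cos\theta_1=\langle v_1,w_1\rangle=\max\{\langle v,w\rangle: v\in V,\ w\in W,\ |v|=|w|=1\}$ and $\cos\theta_2=\max\{\langle v,w\rangle: v\in V,\ w\in W,\ |v|=|w|=1,\ v\perp v_1,\ w\perp w_1\}$. For a regular curve $c:J\to\mathbb{R}^4$ on an open interval $J$, write $\nu_{c(s)}=c'(s)^\perp$ for its normal space at the parameter $s$; the holonomy tube over $c$ through $\xi_0\in\nu_{c(s_0)}$ is $\{c(s)+\xi(s): s\in J\}$, where $\xi$ is the normal vector field along $c$ with $\xi(s_0)=\xi_0$ that is parallel for the normal connection. Suppose that there is a constant $\theta_2$ such that at every $x\in\Sigma$ the principal angles between the tangent plane $T_x\Sigma$ (as a subspace of $\mathbb{R}^4$) and $\Pi$ are $\theta_1=0$ and $\theta_2$. Then there is a rigid motion $\varphi$ of $\mathbb{R}^4$, which can be taken to be a translation, such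 that every $x\in\Sigma$ has arbitrarily small open neighbourhoods $U$ for which the following holds. There are a smooth regular plane curve $c:J\to\Pi$ on an open interval, a parameter $s_0\in J$ with $p=c(s_0)$, and a smooth regular curve $\gamma:K\to\nu_p=c'(s_0)^\perp\cong\mathbb{R}^3$ on a nonempty open interval, such that $\varphi(f(U))$ is the union over $r\in K$ of the holonomy tubes over $c$ through $\gamma(r)$. Moreover $\gamma$ is a helix (a curve of constant slope) of $\nu_p\cong\mathbb{R}^3$: its tangent vectors make a constant angle, equal to $\theta_2$, with a unit vector $N\in\Pi$ normal to $c$ at $p$. -/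

import Mathlib

open Set Topology
open scoped Manifold ContDiff RealInnerProductSpace

/-- Euclidean four-space. -/
abbrev R4 := EuclideanSpace ℝ (Fin 4)

/-- `0 ≤ θ₁ ≤ θ₂ ≤ π / 2` are the principal angles between the subspaces `V` and `W`:
`cos θ₁` is the maximum of `⟪v, w⟫` over unit vectors `v ∈ V`, `w ∈ W`, attained at `(v₁, w₁)`,
and `cos θ₂` is the maximum over those unit vectors with moreover `v ⊥ v₁` and `w ⊥ w₁`. -/
structure ArePrincipalAngles (V W : Submodule ℝ R4) (θ₁ θ₂ : ℝ) : Prop where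
  nonneg : 0 ≤ θ₁
  le : θ₁ ≤ θ₂
  le_pi_div_two : θ₂ ≤ Real.pi / 2
  exists_vectors : ∃ v₁ ∈ V, ∃ w₁ ∈ W, ‖v₁‖ = 1 ∧ ‖w₁‖ = 1 ∧ ⟪v₁, w₁⟫ = Real.cos θ₁ ∧
    IsGreatest {t : ℝ | ∃ v ∈ V, ∃ w ∈ W, ‖v‖ = 1 ∧ ‖w‖ = 1 ∧ t = ⟪v, w⟫} (Real.cos θ₁) ∧
    IsGreatest {t : ℝ | ∃ v ∈ V, ∃ w ∈ W, ‖v‖ = 1 ∧ ‖w‖ = 1 ∧ ⟪v, v₁⟫ = 0 ∧ ⟪w, w₁⟫ = 0 ∧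
      t = ⟪v, w⟫} (Real.cos θ₂)

section Surfaces

variable {M : Type*} [TopologicalSpace M] [ChartedSpace (EuclideanSpace ℝ (Fin 2)) M]

/-- A smooth immersion of a two-dimensional manifold into `ℝ⁴`. -/
structure IsImmersedSurface (f : M → R4) : Prop where
  contMDiff : ContMDiff (𝓡 2) 𝓘(ℝ, R4) ∞ f
  injective_mfderiv : ∀ x, Function.Injective (mfderiv (𝓡 2) 𝓘(ℝ, R4) f x)

/-- The tangent plane at `x` of the surface `f`, as a linear subspace of `ℝ⁴`. -/
noncomputable def tangentPlane (f : M → R4) (x : M) : Submodule ℝ R4 :=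
  LinearMap.range
    (show EuclideanSpace ℝ (Fin 2) →L[ℝ] R4 from mfderiv (𝓡 2) 𝓘(ℝ, R4) f x).toLinearMap

/-- The principal angles between the tangent planes of `f` and the plane `P` are
`θ₁` and `θ₂` at every point. -/
def HasConstantPrincipalAngles (f : M → R4) (P : Submodule ℝ R4) (θ₁ θ₂ : ℝ) : Prop :=
  ∀ x : M, ArePrincipalAngles (tangentPlane f x) P θ₁ θ₂

end Surfaces

/-- `c` restricted to `J` is a smooth regular curve. -/
structure IsRegularCurve (c : ℝ → R4) (J : Set ℝ) : Prop where
  contDiffOn : ContDiffOn ℝ ∞ c J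
  deriv_ne_zero : ∀ s ∈ J, deriv c s ≠ 0

/-- The normal space of the curve `c` at the parameter `s`; it is three-dimensional where
`deriv c s ≠ 0`. -/
noncomputable def normalSpace (c : ℝ → R4) (s : ℝ) : Submodule ℝ R4 :=
  (Submodule.span ℝ {deriv c s})ᗮ

/-- `ξ` is a normal vector field along the curve `c` on `J`, parallel with respect to the normal
connection: its derivative has vanishing normal component. -/
structure IsNormalParallel (c : ℝ → R4) (J : Set ℝ) (ξ : ℝ → R4) : Prop where
  normal : ∀ s ∈ J, ξ s ∈ normalSpace c s
  differentiableAt : ∀ s ∈ J, DifferentiableAt ℝ ξ s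
  parallel : ∀ s ∈ J, (normalSpace c s).starProjection (deriv ξ s) = 0

/-- The holonomy tube over the curve `c` on `J` through the normal vector `ξ₀` at `c s₀`: all
end points `c s + ξ s`, where `ξ` is the parallel transport of `ξ₀` along `c` in the normal
bundle. -/
def holonomyTube (c : ℝ → R4) (J : Set ℝ) (s₀ : ℝ) (ξ₀ : R4) : Set R4 :=
  {q | ∃ ξ : ℝ → R4, IsNormalParallel c J ξ ∧ ξ s₀ = ξ₀ ∧ ∃ s ∈ J, q = c s + ξ s}

/-- `γ` restricted to `K` is a helix (a curve of constant slope) with axis direction `d`: a smooth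
regular curve whose tangent vectors make the constant angle `θ` with `d`. -/
structure IsHelix (γ : ℝ → R4) (K : Set ℝ) (d : R4) (θ : ℝ) : Prop where
  regular : IsRegularCurve γ K
  angle_eq : ∀ r ∈ K, InnerProductGeometry.angle (deriv γ r) d = θ

/-- The set `S` is the union of the holonomy tubes over a smooth regular plane curve `c ⊂ P`
(parametrized by an open interval) through the normal vectors `γ r` at a point `p = c s₀`,
where `γ` is a curve in the normal space of `c` at `p`, parametrized by an open interval, which is
a helix making the angle `θ` with the unit normal `N ∈ P` of the plane curve `c` at `p`. -/
def IsUnionOfHolonomyTubes (P : Submodule ℝ R4) (θ : ℝ) (S : Set R4) : Prop :=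
  ∃ (c γ : ℝ → R4) (a b s₀ a' b' : ℝ) (N : R4),
    s₀ ∈ Ioo a b ∧ a' < b' ∧
    IsRegularCurve c (Ioo a b) ∧ (∀ s ∈ Ioo a b, c s ∈ P) ∧
    N ∈ P ∧ ‖N‖ = 1 ∧ N ∈ normalSpace c s₀ ∧
    (∀ r ∈ Ioo a' b', γ r ∈ normalSpace c s₀) ∧
    IsHelix γ (Ioo a' b') N θ ∧
    S = ⋃ r ∈ Ioo a' b', holonomyTube c (Ioo a b) s₀ (γ r)

/-!
As the first principal angle vanishes, each tangent plane contains a unit vector of `P`, together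
with a vector inclined to `P` at the angle `θ₂`. Let `0 < θ₂`. In coordinates `(s, t)` such that `t`
is the height in a suitable direction of `Pᗮ`, the curves `t = const` are tangent to `P`, so that
the component of the surface in `Pᗮ` is a function `β t` of `t` alone. Since the angle is constant,
the projections of these curves to `P` move in normal direction with the speed `‖β' t‖ * cot θ₂`,
which is the same at all points of a curve. The trajectories orthogonal to such an equidistant
family are straight lines, so after a change of `s` the surface is `c s + R t • n s + β t` with `n`
the unit normal of a plane curve `c`. The vector fields `s ↦ R t • n s + β t` are normal to `c` and
parallel, and `r ↦ R r • n s₀ + β r` is the helix: its velocity has slope `R' / ‖β'‖ = cot θ₂` with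
respect to `n s₀`. If `θ₂ = 0`, the surface lies in a translate of `P`, which is a union of parallel
lines.
-/

section Planes

variable {E : Type*} [NormedAddCommGroup E] [InnerProductSpace ℝ E]

lemma eq_span_pair_of_inner_eq_zero {T : Submodule ℝ E} (hT : Module.finrank ℝ T = 2) {x y : E}
    (hx : x ∈ T) (hy : y ∈ T) (hx₀ : x ≠ 0) (hy₀ : y ≠ 0) (hxy : ⟪x, y⟫ = 0) :
    T = Submodule.span ℝ {x, y} := by
  have : FiniteDimensional ℝ T := Module.finite_of_finrank_pos (by omega)
  have hli : LinearIndependent ℝ ![x, y] := by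
    refine linearIndependent_of_ne_zero_of_inner_eq_zero (fun i ↦ ?_) fun i j hij ↦ ?_
    · fin_cases i <;> assumption
    · fin_cases i <;> fin_cases j <;> simp_all [real_inner_comm]
  refine (Submodule.eq_of_le_of_finrank_eq (Submodule.span_le.2 (pair_subset hx hy)) ?_).symm
  rw [hT, ← Matrix.range_cons_cons_empty x y, finrank_span_eq_card hli, Fintype.card_fin]

lemma exists_eq_smul_add_smul (hE : Module.finrank ℝ E = 2) {x y : E} (hx : x ≠ 0) (hy : y ≠ 0)
    (hxy : ⟪x, y⟫ = 0) (z : E) : ∃ a b : ℝ, z = a • x + b • y := by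
  have htop := eq_span_pair_of_inner_eq_zero ((finrank_top ℝ E).trans hE) Submodule.mem_top
    Submodule.mem_top hx hy hxy
  obtain ⟨a, b, h⟩ := Submodule.mem_span_pair.1 (htop ▸ Submodule.mem_top : z ∈ _)
  exact ⟨a, b, h.symm⟩

lemma exists_eq_smul_of_inner_eq_zero (hE : Module.finrank ℝ E = 2) {x y z : E} (hx : x ≠ 0)
    (hy : y ≠ 0) (hxy : ⟪x, y⟫ = 0) (hxz : ⟪x, z⟫ = 0) : ∃ b : ℝ, z = b • y := by
  obtain ⟨a, b, rfl⟩ := exists_eq_smul_add_smul hE hx hy hxy z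
  have ha : a = 0 := by simpa [inner_add_right, inner_smul_right, hxy, hx] using hxz
  exact ⟨b, by simp [ha]⟩

lemma eq_zero_of_inner_eq_zero (hE : Module.finrank ℝ E = 2) {x y z : E} (hx : x ≠ 0)
    (hy : y ≠ 0) (hxy : ⟪x, y⟫ = 0) (hxz : ⟪x, z⟫ = 0) (hyz : ⟪y, z⟫ = 0) : z = 0 := by
  obtain ⟨b, rfl⟩ := exists_eq_smul_of_inner_eq_zero hE hx hy hxy hxz
  have hb : b = 0 := by simpa [inner_smul_right, hy] using hyz
  rw [hb, zero_smul]

lemma abs_inner_eq_one (hE : Module.finrank ℝ E = 2) {x y z : E} (hx : ‖x‖ = 1) (hy : ‖y‖ = 1)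
    (hz : ‖z‖ = 1) (hxy : ⟪x, y⟫ = 0) (hxz : ⟪x, z⟫ = 0) : |⟪z, y⟫| = 1 := by
  obtain ⟨b, rfl⟩ := exists_eq_smul_of_inner_eq_zero hE (norm_ne_zero_iff.1 (by simp [hx]))
    (norm_ne_zero_iff.1 (by simp [hy])) hxy hxz
  simpa [norm_smul, inner_smul_left, hy] using hz

lemma exists_contDiffAt_unit_normal {X : Type*} [NormedAddCommGroup X] [NormedSpace ℝ X]
    {m : WithTop ℕ∞} (hE : Module.finrank ℝ E = 2) (S : X → E) :
    ∃ N : X → E, ∀ x, ContDiffAt ℝ m S x → S x ≠ 0 →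
      ContDiffAt ℝ m N x ∧ ‖N x‖ = 1 ∧ ⟪N x, S x⟫ = 0 := by
  have : Fact (Module.finrank ℝ E = 2) := ⟨hE⟩
  have : FiniteDimensional ℝ E := Module.finite_of_finrank_pos (by omega)
  let o : Orientation ℝ E (Fin 2) := (Module.finBasisOfFinrankEq ℝ E hE).orientation
  refine ⟨fun x ↦ ‖S x‖⁻¹ • o.rightAngleRotation (S x), fun x hS hx ↦ ⟨?_, ?_, ?_⟩⟩
  · exact ((hS.norm ℝ hx).inv (norm_ne_zero_iff.2 hx)).smul
      (o.rightAngleRotation.toContinuousLinearEquiv.contDiff.contDiffAt.comp x hS)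
  · simp [norm_smul, hx]
  · simp [inner_smul_left]

lemma exists_sign_mul_eventuallyEq {X : Type*} [TopologicalSpace X] {g k : X → ℝ} {x₀ : X}
    (hg : ContinuousAt g x₀) (h : ∀ᶠ x in 𝓝 x₀, |g x| = k x)
    (hk : k x₀ ≠ 0 ∨ k =ᶠ[𝓝 x₀] 0) :
    ∃ σ : ℝ, |σ| = 1 ∧ ∀ᶠ x in 𝓝 x₀, σ * g x = k x := by
  rcases hk with hk | hk
  · rcases (abs_ne_zero.1 (h.self_of_nhds ▸ hk)).lt_or_gt with hneg | hpos
    · refine ⟨-1, by simp, ?_⟩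
      filter_upwards [h, hg.eventually_lt_const hneg] with x hx hx'
      rw [← hx, abs_of_neg hx', neg_one_mul]
    · refine ⟨1, by simp, ?_⟩
      filter_upwards [h, hg.eventually_const_lt hpos] with x hx hx'
      rw [← hx, abs_of_pos hx', one_mul]
  · refine ⟨1, by simp, ?_⟩
    filter_upwards [h, hk] with x hx hx'
    rw [one_mul, hx', Pi.zero_apply]
    exact abs_eq_zero.1 (hx.trans hx')

end Planes

section PrincipalBasis

variable {E : Type*} [NormedAddCommGroup E] [InnerProductSpace ℝ E]

/-- The orthonormal vectors `e, w` of the plane `P` and the vector `η` normal to `P` exhibit `T` as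
a plane that contains `e` and is inclined to `P` at the angle `θ` in the direction of `w`. -/
structure IsPrincipalBasis (T P : Submodule ℝ E) (θ : ℝ) (e w η : E) : Prop where
  left_mem : e ∈ P
  right_mem : w ∈ P
  mem_orthogonal : η ∈ Pᗮ
  norm_left : ‖e‖ = 1
  norm_right : ‖w‖ = 1
  inner_eq_zero : ⟪e, w⟫ = 0
  norm_orthogonal : ‖η‖ = Real.sin θ
  span_eq : T = Submodule.span ℝ {e, Real.cos θ • w + η}

lemma ArePrincipalAngles.exists_isPrincipalBasis {T P : Submodule ℝ R4} {θ : ℝ}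
    (h : ArePrincipalAngles T P 0 θ) (hT : Module.finrank ℝ T = 2)
    (hP : Module.finrank ℝ P = 2) : ∃ e w η, IsPrincipalBasis T P θ e w η := by
  obtain ⟨e, heT, e', heP, he, he', hee', -, ⟨v, hvT, w, hwP, hv, hw, hve, hwe, hvw⟩, -⟩ :=
    h.exists_vectors
  obtain rfl : e = e' := by
    rwa [Real.cos_zero, inner_eq_one_iff_of_norm_eq_one he he'] at hee'
  have hew : ⟪e, w⟫ = 0 := (real_inner_comm _ _).trans hwe
  have hev : ⟪e, v⟫ = 0 := (real_inner_comm _ _).trans hve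
  have hne : ∀ {x : R4}, ‖x‖ = 1 → x ≠ 0 := fun hx ↦ norm_ne_zero_iff.1 (by simp [hx])
  have hη : v - Real.cos θ • w ∈ Pᗮ := by
    rw [eq_span_pair_of_inner_eq_zero hP heP hwP (hne he) (hne hw) hew,
      Submodule.mem_orthogonal]
    intro u hu
    obtain ⟨a, b, rfl⟩ := Submodule.mem_span_pair.1 hu
    simp [inner_add_left, inner_sub_right, inner_smul_left, inner_smul_right, hew, hev, hw,
      hvw, real_inner_comm v w, mul_comm b]
  have hsin : 0 ≤ Real.sin θ :=
    Real.sin_nonneg_of_nonneg_of_le_pi h.le (h.le_pi_div_two.trans (by linarith [Real.pi_pos]))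
  refine ⟨e, w, v - Real.cos θ • w, heP, hwP, hη, he, hw, hew, ?_, ?_⟩
  · rw [← sq_eq_sq₀ (norm_nonneg _) hsin, norm_sub_sq_real, norm_smul, inner_smul_right, ← hvw,
      hv, hw, Real.sin_sq, Real.norm_eq_abs, mul_one, sq_abs]
    ring
  · rw [add_sub_cancel]
    exact eq_span_pair_of_inner_eq_zero hT heT hvT (hne he) (hne hv) hev

namespace IsPrincipalBasis

variable {T P : Submodule ℝ E} {θ : ℝ} {e w η : E}

lemma exists_eq (h : IsPrincipalBasis T P θ e w η) {a : E} (ha : a ∈ T) :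
    ∃ x y : ℝ, a = x • e + y • (Real.cos θ • w + η) := by
  obtain ⟨x, y, hxy⟩ := Submodule.mem_span_pair.1 (h.span_eq ▸ ha)
  exact ⟨x, y, hxy.symm⟩

lemma inner_left (h : IsPrincipalBasis T P θ e w η) (x y : ℝ) :
    ⟪e, x • e + y • (Real.cos θ • w + η)⟫ = x := by
  simp [inner_add_right, inner_smul_right, h.norm_left, h.inner_eq_zero,
    h.mem_orthogonal e h.left_mem]

lemma inner_orthogonal (h : IsPrincipalBasis T P θ e w η) {ν : E} (hν : ν ∈ Pᗮ) (x y : ℝ) :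
    ⟪ν, x • e + y • (Real.cos θ • w + η)⟫ = y * ⟪ν, η⟫ := by
  simp [inner_add_right, inner_smul_right, Submodule.inner_left_of_mem_orthogonal h.left_mem hν,
    Submodule.inner_left_of_mem_orthogonal h.right_mem hν]

lemma orthogonalProjectionOnto_orthogonal [P.HasOrthogonalProjection]
    (h : IsPrincipalBasis T P θ e w η) (x y : ℝ) :
    Pᗮ.orthogonalProjectionOnto (x • e + y • (Real.cos θ • w + η)) = y • ⟨η, h.mem_orthogonal⟩ := by
  simp [Submodule.orthogonalProjectionOnto_orthogonal_apply_eq_zero, h.left_mem, h.right_mem,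
    Submodule.orthogonalProjectionOnto_mem_subspace_eq_self (⟨η, h.mem_orthogonal⟩ : Pᗮ)]

lemma eq_zero_of_inner_eq_zero (h : IsPrincipalBasis T P θ e w η) (hθ : Real.sin θ ≠ 0) {a : E}
    (ha : a ∈ T) (he : ⟪e, a⟫ = 0) (hη : ⟪η, a⟫ = 0) : a = 0 := by
  obtain ⟨x, y, rfl⟩ := h.exists_eq ha
  rw [h.inner_left] at he
  rw [h.inner_orthogonal h.mem_orthogonal, real_inner_self_eq_norm_sq, h.norm_orthogonal] at hη
  simp_all

lemma mem_of_inner_eq_zero (h : IsPrincipalBasis T P θ e w η) {ν a b : E} (hν : ν ∈ Pᗮ)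
    (ha : a ∈ T) (hb : b ∈ T) (hνa : ⟪ν, a⟫ = 0) (hνb : ⟪ν, b⟫ ≠ 0) : a ∈ P := by
  obtain ⟨x, y, rfl⟩ := h.exists_eq ha
  obtain ⟨x', y', rfl⟩ := h.exists_eq hb
  rw [h.inner_orthogonal hν] at hνa hνb
  have hy : y = 0 := (mul_eq_zero.1 hνa).resolve_right (right_ne_zero_of_mul hνb)
  simpa [hy] using P.smul_mem x h.left_mem

lemma le_of_eq_zero (h : IsPrincipalBasis T P 0 e w η) : T ≤ P := by
  have hη : η = 0 := by simpa using h.norm_orthogonal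
  rw [h.span_eq, Submodule.span_le, hη]
  exact pair_subset h.left_mem (by simpa using h.right_mem)

lemma abs_inner_mul_sin [P.HasOrthogonalProjection] (h : IsPrincipalBasis T P θ e w η)
    (hP : Module.finrank ℝ P = 2) (hsin : 0 < Real.sin θ) (hcos : 0 ≤ Real.cos θ) {τ n : P}
    (hτ : (τ : E) ∈ T) (hτ₀ : τ ≠ 0) (hn : ‖n‖ = 1) (hnτ : ⟪n, τ⟫ = 0) {a : E} (ha : a ∈ T) :
    |⟪n, P.orthogonalProjectionOnto a⟫| * Real.sin θ
      = Real.cos θ * ‖Pᗮ.orthogonalProjectionOnto a‖ := by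
  obtain ⟨x, y, rfl⟩ := h.exists_eq ha
  obtain ⟨x', y', hτe⟩ := h.exists_eq hτ
  have hη₀ : (⟨η, h.mem_orthogonal⟩ : Pᗮ) ≠ 0 := by
    rw [← norm_ne_zero_iff, Submodule.coe_norm, h.norm_orthogonal]
    exact hsin.ne'
  have hy' : y' = 0 := by
    have hτ' := h.orthogonalProjectionOnto_orthogonal x' y'
    rw [← hτe, Submodule.orthogonalProjectionOnto_orthogonal_apply_eq_zero τ.2] at hτ'
    exact (smul_eq_zero.1 hτ'.symm).resolve_right hη₀
  have hτx : τ = x' • ⟨e, h.left_mem⟩ := Subtype.ext (by simpa [hy'] using hτe)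
  have hne : ⟪(n : E), e⟫ = 0 := by
    rw [hτx, inner_smul_right] at hnτ
    exact (mul_eq_zero.1 hnτ).resolve_left (by rintro rfl; simp [hτx] at hτ₀)
  have hnw : |⟪(n : E), w⟫| = 1 :=
    abs_inner_eq_one hP (x := ⟨e, h.left_mem⟩) (y := ⟨w, h.right_mem⟩) h.norm_left h.norm_right hn
      h.inner_eq_zero ((real_inner_comm _ _).trans hne)
  have hnη : ⟪(n : E), η⟫ = 0 := h.mem_orthogonal n n.2
  have hna : ⟪(n : E), x • e + y • (Real.cos θ • w + η)⟫ = y * (Real.cos θ * ⟪(n : E), w⟫) := by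
    simp [inner_add_right, inner_smul_right, hne, hnη]
  rw [h.orthogonalProjectionOnto_orthogonal,
    Submodule.inner_orthogonalProjectionOnto_eq_of_mem_left, hna, abs_mul, abs_mul, hnw,
    abs_of_nonneg hcos, norm_smul, Submodule.coe_norm, h.norm_orthogonal, Real.norm_eq_abs]
  ring

end IsPrincipalBasis

end PrincipalBasis

section Calculus

variable {X Y : Type*} [NormedAddCommGroup X] [NormedSpace ℝ X] [NormedAddCommGroup Y]
  [NormedSpace ℝ Y]

lemma fderiv_clm_comp_apply {Z : Type*} [NormedAddCommGroup Z] [NormedSpace ℝ Z] (L : Y →L[ℝ] Z)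
    {g : X → Y} {x : X} (hg : DifferentiableAt ℝ g x) (v : X) :
    fderiv ℝ (fun y ↦ L (g y)) x v = L (fderiv ℝ g x v) :=
  DFunLike.congr_fun (L.hasFDerivAt.comp x hg.hasFDerivAt).fderiv v

lemma exists_smooth_localInverse [FiniteDimensional ℝ X] [FiniteDimensional ℝ Y]
    (hXY : Module.finrank ℝ X = Module.finrank ℝ Y) {G : X → Y} {x : X}
    (hG : ∀ᶠ y in 𝓝 x, ContDiffAt ℝ ∞ G y) (hinj : Function.Injective (fderiv ℝ G x)) :
    ∃ φ : OpenPartialHomeomorph X Y, ⇑φ = G ∧ x ∈ φ.source ∧ ∀ᶠ z in 𝓝 (φ x),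
      ContDiffAt ℝ ∞ φ.symm z ∧ Function.Injective (fderiv ℝ φ.symm z) := by
  have : CompleteSpace X := FiniteDimensional.complete ℝ X
  have hGx := hG.self_of_nhds
  let L := (LinearEquiv.ofInjectiveOfFinrankEq (fderiv ℝ G x).toLinearMap hinj
    hXY).toContinuousLinearEquiv
  have hL : (L : X →L[ℝ] Y) = fderiv ℝ G x := by ext v; rfl
  have hGL : HasFDerivAt G (L : X →L[ℝ] Y) x :=
    hL ▸ (hGx.differentiableAt (by simp)).hasFDerivAt
  let φ := hGx.toOpenPartialHomeomorph G hGL (by simp)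
  have hφ : ⇑φ = G := hGx.toOpenPartialHomeomorph_coe hGL (by simp)
  have hx : x ∈ φ.source := hGx.mem_toOpenPartialHomeomorph_source hGL (by simp)
  have hinv : ∀ᶠ y in 𝓝 x, fderiv ℝ G y ∈ range ((↑) : (X ≃L[ℝ] Y) → X →L[ℝ] Y) :=
    (hGx.fderiv_right (m := 0) (by simp)).continuousAt.eventually_mem
      (hL ▸ ContinuousLinearEquiv.nhds L)
  refine ⟨φ, hφ, hx, ?_⟩
  filter_upwards [φ.open_target.mem_nhds (φ.map_source hx),
    (φ.eventually_nhds' _ hx).2 (hG.and hinv)] with z hz ⟨hGz, A, hA⟩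
  have hGA : HasFDerivAt G (A : X →L[ℝ] Y) (φ.symm z) :=
    hA ▸ (hGz.differentiableAt (by simp)).hasFDerivAt
  refine ⟨φ.contDiffAt_symm hz (by rwa [hφ]) (by rwa [hφ]), ?_⟩
  rw [(φ.hasFDerivAt_symm hz (by rwa [hφ])).fderiv]
  exact A.symm.injective

lemma exists_smooth_coordinates [FiniteDimensional ℝ X] (hX : Module.finrank ℝ X = 2)
    {g h : X → ℝ} {x : X} (hg : ∀ᶠ y in 𝓝 x, ContDiffAt ℝ ∞ g y)
    (hh : ∀ᶠ y in 𝓝 x, ContDiffAt ℝ ∞ h y)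
    (hinj : ∀ v, fderiv ℝ g x v = 0 → fderiv ℝ h x v = 0 → v = 0) :
    ∃ φ : OpenPartialHomeomorph X (ℝ × ℝ), φ x = (g x, h x) ∧ x ∈ φ.source ∧ ∀ᶠ z in 𝓝 (φ x),
      (ContDiffAt ℝ ∞ φ.symm z ∧ Function.Injective (fderiv ℝ φ.symm z)) ∧
        g (φ.symm z) = z.1 ∧ h (φ.symm z) = z.2 := by
  have hd : fderiv ℝ (fun y ↦ (g y, h y)) x = (fderiv ℝ g x).prod (fderiv ℝ h x) :=
    (hg.self_of_nhds.differentiableAt (by simp)).fderiv_prodMk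
      (hh.self_of_nhds.differentiableAt (by simp))
  obtain ⟨φ, hφ, hx, hsymm⟩ := exists_smooth_localInverse (Y := ℝ × ℝ) (by simp [hX])
    (G := fun y ↦ (g y, h y)) (by filter_upwards [hg, hh] with y h₁ h₂ using h₁.prodMk h₂)
    ((injective_iff_map_eq_zero _).2 fun v hv ↦ by
      rw [hd, ContinuousLinearMap.prod_apply, Prod.mk_eq_zero] at hv
      exact hinj v hv.1 hv.2)
  refine ⟨φ, congrFun hφ x, hx, ?_⟩
  filter_upwards [hsymm, φ.open_target.mem_nhds (φ.map_source hx)] with z hz hzt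
  have hz' := (congrFun hφ _).symm.trans (φ.right_inv hzt)
  exact ⟨hz, congrArg Prod.fst hz', congrArg Prod.snd hz'⟩

lemma eventually_eq_of_fderiv_eq_zero {g : X → Y} {x₀ : X}
    (hg : ∀ᶠ x in 𝓝 x₀, DifferentiableAt ℝ g x ∧ fderiv ℝ g x = 0) :
    ∀ᶠ x in 𝓝 x₀, g x = g x₀ := by
  obtain ⟨ε, hε, hball⟩ := Metric.eventually_nhds_iff_ball.1 hg
  filter_upwards [Metric.ball_mem_nhds x₀ hε] with x hx
  exact Metric.isOpen_ball.is_const_of_fderiv_eq_zero (convex_ball x₀ ε).isPreconnected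
    (fun y hy ↦ (hball y hy).1.differentiableWithinAt) (fun y hy ↦ (hball y hy).2) hx
    (Metric.mem_ball_self hε)

lemma eventually_eq_of_fderiv_apply_eq_zero {g : X → Y} {x₀ v : X}
    (hg : ∀ᶠ x in 𝓝 x₀, DifferentiableAt ℝ g x ∧ fderiv ℝ g x v = 0) {p : X → X}
    (hp : ContinuousAt p x₀) (hp₀ : p x₀ = x₀) (hpv : ∀ x, ∃ t : ℝ, p x = x + t • v) :
    ∀ᶠ x in 𝓝 x₀, g x = g (p x) := by
  obtain ⟨ε, hε, hball⟩ := Metric.eventually_nhds_iff_ball.1 hg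
  have hB : Metric.ball x₀ ε ∈ 𝓝 x₀ := Metric.ball_mem_nhds x₀ hε
  filter_upwards [hB, hp.preimage_mem_nhds (t := Metric.ball x₀ ε) (by rwa [hp₀])] with x hx hpx
  obtain ⟨t, ht⟩ := hpv x
  rw [mem_preimage, ht] at hpx
  have hline : ∀ r : ℝ, HasDerivAt (fun r : ℝ ↦ x + r • t • v) (t • v) r := fun r ↦ by
    simpa using ((hasDerivAt_id r).smul_const (t • v)).const_add x
  have hmem : ∀ r ∈ Icc (0 : ℝ) 1, x + r • t • v ∈ Metric.ball x₀ ε := fun r hr ↦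
    (convex_ball x₀ ε).add_smul_mem hx hpx hr
  have hd : ∀ r ∈ Icc (0 : ℝ) 1, HasDerivAt (fun r : ℝ ↦ g (x + r • t • v)) 0 r := by
    intro r hr
    obtain ⟨hgd, hgv⟩ := hball _ (hmem r hr)
    simpa [hgv, Function.comp_def] using hgd.hasFDerivAt.comp_hasDerivAt r (hline r)
  have hconst := constant_of_has_deriv_right_zero
    (fun r hr ↦ (hd r hr).continuousAt.continuousWithinAt)
    (fun r hr ↦ (hd r (Ico_subset_Icc_self hr)).hasDerivWithinAt) 1 (right_mem_Icc.2 zero_le_one)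
  simpa [ht] using hconst.symm

lemma eventually_eq_of_fderiv_one_zero {g : ℝ × ℝ → Y} {z₀ : ℝ × ℝ}
    (hg : ∀ᶠ z in 𝓝 z₀, DifferentiableAt ℝ g z ∧ fderiv ℝ g z (1, 0) = 0) :
    ∀ᶠ z in 𝓝 z₀, g z = g (z₀.1, z.2) :=
  eventually_eq_of_fderiv_apply_eq_zero hg (by fun_prop) rfl
    fun z ↦ ⟨z₀.1 - z.1, Prod.ext (by simp) (by simp)⟩

lemma eventually_eq_of_fderiv_zero_one {g : ℝ × ℝ → Y} {z₀ : ℝ × ℝ}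
    (hg : ∀ᶠ z in 𝓝 z₀, DifferentiableAt ℝ g z ∧ fderiv ℝ g z (0, 1) = 0) :
    ∀ᶠ z in 𝓝 z₀, g z = g (z.1, z₀.2) :=
  eventually_eq_of_fderiv_apply_eq_zero hg (by fun_prop) rfl
    fun z ↦ ⟨z₀.2 - z.2, Prod.ext (by simp) (by simp)⟩

lemma hasDerivAt_subtype_coe {P : Submodule ℝ Y} {c : ℝ → P} {c' : P} {s : ℝ}
    (h : HasDerivAt c c' s) : HasDerivAt (fun r ↦ (c r : Y)) c' s :=
  P.subtypeL.hasFDerivAt.comp_hasDerivAt s h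

lemma exists_smooth_primitive [CompleteSpace Y] {κ : ℝ → Y} {t₀ : ℝ}
    (hκ : ∀ᶠ t in 𝓝 t₀, ContDiffAt ℝ ∞ κ t) :
    ∃ R : ℝ → Y, R t₀ = 0 ∧ ∀ᶠ t in 𝓝 t₀, ContDiffAt ℝ ∞ R t ∧ deriv R t = κ t := by
  obtain ⟨ε, hε, hball⟩ := Metric.eventually_nhds_iff_ball.1 hκ
  have hκc : ContDiffOn ℝ ∞ κ (Metric.ball t₀ ε) := fun t ht ↦ (hball t ht).contDiffWithinAt
  have hd : ∀ t ∈ Metric.ball t₀ ε, HasDerivAt (fun u ↦ ∫ x in t₀..u, κ x) (κ t) t := by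
    intro t ht
    have hint : uIcc t₀ t ⊆ Metric.ball t₀ ε :=
      (convex_ball t₀ ε).ordConnected.uIcc_subset (Metric.mem_ball_self hε) ht
    exact intervalIntegral.integral_hasDerivAt_right
      (hκc.continuousOn.mono hint).intervalIntegrable
      (hκc.continuousOn.stronglyMeasurableAtFilter Metric.isOpen_ball t ht)
      (hball t ht).continuousAt
  have hR : ContDiffOn ℝ ∞ (fun u ↦ ∫ x in t₀..u, κ x) (Metric.ball t₀ ε) :=
    (contDiffOn_infty_iff_deriv_of_isOpen Metric.isOpen_ball).2
      ⟨fun t ht ↦ (hd t ht).differentiableAt.differentiableWithinAt,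
        hκc.congr fun t ht ↦ (hd t ht).deriv⟩
  refine ⟨fun u ↦ ∫ x in t₀..u, κ x, intervalIntegral.integral_same, ?_⟩
  filter_upwards [Metric.ball_mem_nhds t₀ hε] with t ht
  exact ⟨hR.contDiffAt (Metric.isOpen_ball.mem_nhds ht), (hd t ht).deriv⟩

end Calculus

section Straightening

variable {Y : Type*} [NormedAddCommGroup Y] [NormedSpace ℝ Y]

lemma apply_eq_smul_apply_one_zero {L : ℝ × ℝ →L[ℝ] Y} {a : ℝ} (ha : L (-a, 1) = 0) (v : ℝ × ℝ) :
    L v = (v.1 + v.2 * a) • L (1, 0) := by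
  have hv : v = (v.1 + v.2 * a) • (1, 0) + v.2 • (-a, 1) := Prod.ext (by simp) (by simp)
  conv_lhs => rw [hv, map_add, map_smul, map_smul, ha, smul_zero, add_zero]

lemma fderiv_comp_apply_zero_one_eq_zero {g : ℝ × ℝ → Y} {ψ : ℝ × ℝ → ℝ × ℝ} {z : ℝ × ℝ} {a : ℝ}
    (hg : DifferentiableAt ℝ g (ψ z)) (hψ : DifferentiableAt ℝ ψ z)
    (ha : fderiv ℝ g (ψ z) (-a, 1) = 0) {ℓ : Y →L[ℝ] ℝ} (hℓ : ℓ (fderiv ℝ g (ψ z) (1, 0)) ≠ 0)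
    (hfst : ∀ᶠ y in 𝓝 z, ℓ (g (ψ y)) = y.1) : fderiv ℝ (g ∘ ψ) z (0, 1) = 0 := by
  have hd : fderiv ℝ (fun y ↦ ℓ (g (ψ y))) z = fderiv ℝ Prod.fst z :=
    Filter.EventuallyEq.fderiv_eq hfst
  have hℓz : ℓ (fderiv ℝ (g ∘ ψ) z (0, 1)) = 0 := by
    rw [← fderiv_clm_comp_apply ℓ (hg.comp z hψ)]
    simpa [fderiv_fst] using DFunLike.congr_fun hd (0, 1)
  rw [fderiv_comp z hg hψ, ContinuousLinearMap.comp_apply,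
    apply_eq_smul_apply_one_zero ha] at hℓz ⊢
  rw [map_smul] at hℓz
  rw [(smul_eq_zero.1 hℓz).resolve_right hℓ, zero_smul]

/-- The level curves of `g` are the integral curves of the field `(-a, 1)`; they become vertical
lines in the coordinates `(ℓ ∘ g, t)`. -/
lemma exists_straightening {g : ℝ × ℝ → Y} {z₀ : ℝ × ℝ}
    (hg : ∀ᶠ z in 𝓝 z₀, ContDiffAt ℝ ∞ g z)
    (hker : ∀ᶠ z in 𝓝 z₀, ∃ a : ℝ, fderiv ℝ g z (-a, 1) = 0) (ℓ : Y →L[ℝ] ℝ)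
    (hℓ : ℓ (fderiv ℝ g z₀ (1, 0)) ≠ 0) :
    ∃ φ : OpenPartialHomeomorph (ℝ × ℝ) (ℝ × ℝ), z₀ ∈ φ.source ∧ (φ z₀).2 = z₀.2 ∧
      ∀ᶠ z in 𝓝 (φ z₀), ContDiffAt ℝ ∞ φ.symm z ∧ ℓ (g (φ.symm z)) = z.1 ∧
        (φ.symm z).2 = z.2 ∧ g (φ.symm z) = g (φ.symm (z.1, (φ z₀).2)) := by
  obtain ⟨φ, hφ, hmem, hφs⟩ := exists_smooth_coordinates (g := fun z ↦ ℓ (g z)) (h := Prod.snd)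
    (by simp) (hg.mono fun z hz ↦ ℓ.contDiff.contDiffAt.comp z hz)
    (Filter.Eventually.of_forall fun z ↦ contDiffAt_snd) (fun v hv₁ hv₂ ↦ by
      obtain ⟨a, ha⟩ := hker.self_of_nhds
      have hv₂ : v.2 = 0 := by simpa [fderiv_snd] using hv₂
      rw [fderiv_clm_comp_apply ℓ (hg.self_of_nhds.differentiableAt (by simp)),
        apply_eq_smul_apply_one_zero ha, hv₂, zero_mul, add_zero, map_smul] at hv₁
      exact Prod.ext ((smul_eq_zero.1 hv₁).resolve_right hℓ) hv₂)
  have hℓne : ∀ᶠ z in 𝓝 z₀, ℓ (fderiv ℝ g z (1, 0)) ≠ 0 :=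
    (ℓ.continuous.continuousAt.comp ((hg.self_of_nhds.fderiv_right (m := 0)
      (by simp)).continuousAt.clm_apply continuousAt_const)).eventually_ne hℓ
  have hvert : ∀ᶠ z in 𝓝 (φ z₀), DifferentiableAt ℝ (g ∘ φ.symm) z ∧
      fderiv ℝ (g ∘ φ.symm) z (0, 1) = 0 := by
    filter_upwards [hφs.eventually_nhds,
      (φ.eventually_nhds' _ hmem).2 (hg.and (hker.and hℓne))] with z hz ⟨hgz, ⟨a, ha⟩, hne⟩
    have hφd : DifferentiableAt ℝ φ.symm z := hz.self_of_nhds.1.1.differentiableAt (by simp)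
    have hgd : DifferentiableAt ℝ g (φ.symm z) := hgz.differentiableAt (by simp)
    exact ⟨hgd.comp z hφd,
      fderiv_comp_apply_zero_one_eq_zero hgd hφd ha hne (hz.mono fun _ h ↦ h.2.1)⟩
  refine ⟨φ, hmem, by rw [hφ], ?_⟩
  filter_upwards [hφs, eventually_eq_of_fderiv_zero_one hvert] with z hz hconst
  exact ⟨hz.1.1, hz.2.1, hz.2.2, hconst⟩

end Straightening

section EquidistantFamilies

variable {X V : Type*} [NormedAddCommGroup X] [NormedSpace ℝ X] [NormedAddCommGroup V]
  [InnerProductSpace ℝ V]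

lemma inner_fderiv_eq_zero_of_norm_eq_one {N : X → V} {x : X} (hN : DifferentiableAt ℝ N x)
    (h : ∀ᶠ y in 𝓝 x, ‖N y‖ = 1) (v : X) : ⟪N x, fderiv ℝ N x v⟫ = 0 := by
  have hconst : (fun y ↦ ⟪N y, N y⟫) =ᶠ[𝓝 x] fun _ ↦ (1 : ℝ) :=
    h.mono fun y hy ↦ by simp [hy]
  have hd := fderiv_inner_apply ℝ hN hN v
  rw [hconst.fderiv_eq, fderiv_const_apply, zero_apply,
    real_inner_comm (N x)] at hd
  linarith

lemma inner_fderiv_fderiv_add_eq_zero {N u : X → V} {x v : X} (hN : DifferentiableAt ℝ N x)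
    (hu : DifferentiableAt ℝ (fderiv ℝ u) x) {w : X}
    (h : fderiv ℝ (fun y ↦ ⟪N y, fderiv ℝ u y v⟫) x w = 0) :
    ⟪N x, fderiv ℝ (fderiv ℝ u) x w v⟫ + ⟪fderiv ℝ N x w, fderiv ℝ u x v⟫ = 0 := by
  rw [fderiv_inner_apply ℝ hN (hu.clm_apply (differentiableAt_const v)), fderiv_clm_apply hu
    (differentiableAt_const v)] at h
  simpa using h

/-- The curves `u (·, t)` are regular near `z.1` with unit normal `N (·, t)`, and as `t` varies they
move in the direction of `N` with a speed `κ t` that does not depend on the point of the curve. -/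
structure IsEquidistantFamilyAt (u N : ℝ × ℝ → V) (κ : ℝ → ℝ) (z : ℝ × ℝ) : Prop where
  contDiffAt : ContDiffAt ℝ ∞ u z
  contDiffAt_normal : ContDiffAt ℝ ∞ N z
  contDiffAt_speed : ContDiffAt ℝ ∞ κ z.2
  norm_eq_one : ‖N z‖ = 1
  fderiv_ne_zero : fderiv ℝ u z (1, 0) ≠ 0
  inner_fst : ⟪N z, fderiv ℝ u z (1, 0)⟫ = 0
  inner_snd : ⟪N z, fderiv ℝ u z (0, 1)⟫ = κ z.2

namespace IsEquidistantFamilyAt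

variable {u N : ℝ × ℝ → V} {κ : ℝ → ℝ} {z : ℝ × ℝ}

lemma differentiableAt (h : IsEquidistantFamilyAt u N κ z) : DifferentiableAt ℝ u z :=
  h.contDiffAt.differentiableAt (by simp)

lemma differentiableAt_normal (h : IsEquidistantFamilyAt u N κ z) : DifferentiableAt ℝ N z :=
  h.contDiffAt_normal.differentiableAt (by simp)

lemma inner_fderiv (h : IsEquidistantFamilyAt u N κ z) (v : ℝ × ℝ) :
    ⟪N z, fderiv ℝ u z v⟫ = v.2 * κ z.2 := by
  have hv : v = v.1 • (1, 0) + v.2 • (0, 1) := Prod.ext (by simp) (by simp)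
  rw [hv, map_add, map_smul, map_smul, inner_add_right, inner_smul_right, inner_smul_right,
    h.inner_fst, h.inner_snd]
  simp

lemma differentiableAt_fderiv (h : IsEquidistantFamilyAt u N κ z) :
    DifferentiableAt ℝ (fderiv ℝ u) z :=
  ((contDiffAt_infty.1 h.contDiffAt 2).fderiv_right (m := 1) (by norm_num)).differentiableAt
    (by simp)

lemma inner_fderiv_normal (h : ∀ᶠ z in 𝓝 z, IsEquidistantFamilyAt u N κ z) (v : ℝ × ℝ) :
    ⟪N z, fderiv ℝ N z v⟫ = 0 :=
  inner_fderiv_eq_zero_of_norm_eq_one h.self_of_nhds.differentiableAt_normal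
    (h.mono fun _ h ↦ h.norm_eq_one) v

lemma inner_fderiv_fderiv (h : ∀ᶠ z in 𝓝 z, IsEquidistantFamilyAt u N κ z) {v : ℝ × ℝ}
    (hv : fderiv ℝ u z v = κ z.2 • N z) : ⟪N z, fderiv ℝ (fderiv ℝ u) z (1, 0) v⟫ = 0 := by
  have hz := h.self_of_nhds
  have hspeed : fderiv ℝ (fun z ↦ ⟪N z, fderiv ℝ u z v⟫) z (1, 0) = 0 := by
    have heq : (fun z ↦ ⟪N z, fderiv ℝ u z v⟫) =ᶠ[𝓝 z] fun z ↦ v.2 * (κ ∘ Prod.snd) z :=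
      h.mono fun z hz ↦ hz.inner_fderiv v
    have hκ := hz.contDiffAt_speed.differentiableAt (by simp)
    rw [heq.fderiv_eq, fderiv_const_mul (hκ.comp z differentiableAt_snd),
      fderiv_comp z hκ differentiableAt_snd]
    simp [fderiv_snd]
  simpa [hv, inner_smul_right, real_inner_comm, inner_fderiv_normal h] using
    inner_fderiv_fderiv_add_eq_zero hz.differentiableAt_normal hz.differentiableAt_fderiv hspeed

/-- That is, the trajectories orthogonal to an equidistant family are straight lines. -/
lemma exists_fderiv_eq (hV : Module.finrank ℝ V = 2)
    (h : ∀ᶠ z in 𝓝 z, IsEquidistantFamilyAt u N κ z) :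
    ∃ a : ℝ, fderiv ℝ u z (-a, 1) = κ z.2 • N z ∧ fderiv ℝ N z (-a, 1) = 0 := by
  have hz := h.self_of_nhds
  have hNz : N z ≠ 0 := norm_ne_zero_iff.1 (by simp [hz.norm_eq_one])
  obtain ⟨a, ha⟩ := exists_eq_smul_of_inner_eq_zero hV hNz hz.fderiv_ne_zero hz.inner_fst
    (z := fderiv ℝ u z (0, 1) - κ z.2 • N z)
    (by simp [inner_sub_right, inner_smul_right, hz.inner_snd, hz.norm_eq_one])
  have hua : fderiv ℝ u z (-a, 1) = κ z.2 • N z := by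
    have hv : ((-a, 1) : ℝ × ℝ) = (0, 1) - a • (1, 0) := by simp
    rw [hv, map_sub, map_smul, ← ha, sub_sub_cancel]
  have hnormal : fderiv ℝ (fun z ↦ ⟪N z, fderiv ℝ u z (1, 0)⟫) z (-a, 1) = 0 := by
    have heq : (fun z ↦ ⟪N z, fderiv ℝ u z (1, 0)⟫) =ᶠ[𝓝 z] fun _ ↦ (0 : ℝ) :=
      h.mono fun z hz ↦ hz.inner_fst
    rw [heq.fderiv_eq, fderiv_const_apply, zero_apply]
  have hsymm : fderiv ℝ (fderiv ℝ u) z (-a, 1) (1, 0) = fderiv ℝ (fderiv ℝ u) z (1, 0) (-a, 1) :=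
    (contDiffAt_infty.1 hz.contDiffAt 2).isSymmSndFDerivAt (by simp) _ _
  have hinner := inner_fderiv_fderiv_add_eq_zero hz.differentiableAt_normal
    hz.differentiableAt_fderiv hnormal
  rw [hsymm, inner_fderiv_fderiv h hua, zero_add, real_inner_comm] at hinner
  exact ⟨a, hua, eq_zero_of_inner_eq_zero hV hNz hz.fderiv_ne_zero hz.inner_fst
    (inner_fderiv_normal h _) hinner⟩

lemma fderiv_offset (h : IsEquidistantFamilyAt u N κ z) {R : ℝ → ℝ}
    (hR : DifferentiableAt ℝ R z.2) (hRκ : deriv R z.2 = κ z.2) (v : ℝ × ℝ) :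
    fderiv ℝ (fun z ↦ u z - R z.2 • N z) z v =
      fderiv ℝ u z v - (R z.2 • fderiv ℝ N z v + (v.2 * κ z.2) • N z) := by
  have hRd : HasFDerivAt (fun z : ℝ × ℝ ↦ R z.2) _ z :=
    hR.hasDerivAt.comp_hasFDerivAt z (hasFDerivAt_snd (𝕜 := ℝ) (p := z))
  rw [(h.differentiableAt.hasFDerivAt.fun_sub
    (hRd.fun_smul h.differentiableAt_normal.hasFDerivAt)).fderiv]
  simp [hRκ, mul_comm]

lemma fderiv_offset_apply_neg_one (h : IsEquidistantFamilyAt u N κ z) {R : ℝ → ℝ}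
    (hR : DifferentiableAt ℝ R z.2) (hRκ : deriv R z.2 = κ z.2) {a : ℝ}
    (hu : fderiv ℝ u z (-a, 1) = κ z.2 • N z) (hN : fderiv ℝ N z (-a, 1) = 0) :
    fderiv ℝ (fun z ↦ u z - R z.2 • N z) z (-a, 1) = 0 := by
  rw [h.fderiv_offset hR hRκ, hu, hN]
  simp

lemma inner_fderiv_offset (h : ∀ᶠ z in 𝓝 z, IsEquidistantFamilyAt u N κ z) {R : ℝ → ℝ}
    (hR : DifferentiableAt ℝ R z.2) (hRκ : deriv R z.2 = κ z.2) (v : ℝ × ℝ) :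
    ⟪fderiv ℝ (fun z ↦ u z - R z.2 • N z) z v, N z⟫ = 0 := by
  rw [h.self_of_nhds.fderiv_offset hR hRκ, real_inner_comm]
  simp [inner_sub_right, inner_add_right, inner_smul_right, inner_fderiv_normal h,
    h.self_of_nhds.inner_fderiv, h.self_of_nhds.norm_eq_one]

end IsEquidistantFamilyAt

/-- `c` is a smooth regular curve near the parameter `s`, with differentiable unit normal `n`. -/
structure IsFramedCurveAt (c n : ℝ → V) (s : ℝ) : Prop where
  contDiffAt : ContDiffAt ℝ ∞ c s
  differentiableAt_normal : DifferentiableAt ℝ n s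
  deriv_ne_zero : deriv c s ≠ 0
  norm_eq_one : ‖n s‖ = 1
  inner_eq_zero : ⟪deriv c s, n s⟫ = 0

lemma IsEquidistantFamilyAt.contDiffAt_offset {u N : ℝ × ℝ → V} {κ R : ℝ → ℝ} {z : ℝ × ℝ}
    (h : IsEquidistantFamilyAt u N κ z) (hR : ContDiffAt ℝ ∞ R z.2) :
    ContDiffAt ℝ ∞ (fun z ↦ u z - R z.2 • N z) z :=
  h.contDiffAt.sub ((hR.comp z contDiffAt_snd).smul h.contDiffAt_normal)

lemma IsEquidistantFamilyAt.isFramedCurveAt {u N : ℝ × ℝ → V} {κ R : ℝ → ℝ} {ψ : ℝ → ℝ × ℝ}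
    {s : ℝ} (h : ∀ᶠ z in 𝓝 (ψ s), IsEquidistantFamilyAt u N κ z)
    (hR : ContDiffAt ℝ ∞ R (ψ s).2) (hRκ : deriv R (ψ s).2 = κ (ψ s).2)
    (hψ : ContDiffAt ℝ ∞ ψ s) {ℓ : V →L[ℝ] ℝ}
    (hℓ : ∀ᶠ r in 𝓝 s, ℓ (u (ψ r) - R (ψ r).2 • N (ψ r)) = r) :
    IsFramedCurveAt (fun r ↦ u (ψ r) - R (ψ r).2 • N (ψ r)) (fun r ↦ N (ψ r)) s := by
  have hs := h.self_of_nhds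
  have hw : ContDiffAt ℝ ∞ (fun z ↦ u z - R z.2 • N z) (ψ s) := hs.contDiffAt_offset hR
  have hc : HasDerivAt (fun r ↦ u (ψ r) - R (ψ r).2 • N (ψ r))
      (fderiv ℝ (fun z ↦ u z - R z.2 • N z) (ψ s) (deriv ψ s)) s :=
    (hw.differentiableAt (by simp)).hasFDerivAt.comp_hasDerivAt s
      (hψ.differentiableAt (by simp)).hasDerivAt
  refine ⟨hw.comp s hψ, hs.differentiableAt_normal.comp s (hψ.differentiableAt (by simp)),
    fun h₀ ↦ ?_, hs.norm_eq_one, ?_⟩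
  · have hid := (ℓ.hasFDerivAt.comp_hasDerivAt s hc).congr_of_eventuallyEq
      (Filter.EventuallyEq.symm hℓ)
    rw [← hc.deriv, h₀, map_zero] at hid
    exact zero_ne_one (hid.unique (hasDerivAt_id s))
  · rw [hc.deriv]
    exact inner_fderiv_offset h (hR.differentiableAt (by simp)) hRκ _

lemma IsEquidistantFamilyAt.exists_straightening_offset (hV : Module.finrank ℝ V = 2)
    {u N : ℝ × ℝ → V} {κ R : ℝ → ℝ} {z₀ : ℝ × ℝ}
    (h : ∀ᶠ z in 𝓝 z₀, IsEquidistantFamilyAt u N κ z) (hR₀ : R z₀.2 = 0)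
    (hR : ∀ᶠ t in 𝓝 z₀.2, ContDiffAt ℝ ∞ R t ∧ deriv R t = κ t) :
    ∃ (φ : OpenPartialHomeomorph (ℝ × ℝ) (ℝ × ℝ)) (ℓ : V →L[ℝ] ℝ),
      z₀ ∈ φ.source ∧ (φ z₀).2 = z₀.2 ∧
      ∀ᶠ z in 𝓝 (φ z₀), ContDiffAt ℝ ∞ φ.symm z ∧ (φ.symm z).2 = z.2 ∧
        ℓ (u (φ.symm z) - R (φ.symm z).2 • N (φ.symm z)) = z.1 ∧
        u (φ.symm z) - R (φ.symm z).2 • N (φ.symm z) = u (φ.symm (z.1, (φ z₀).2)) -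
          R (φ.symm (z.1, (φ z₀).2)).2 • N (φ.symm (z.1, (φ z₀).2)) ∧
        N (φ.symm z) = N (φ.symm (z.1, (φ z₀).2)) := by
  have hR' : ∀ᶠ z : ℝ × ℝ in 𝓝 z₀, ContDiffAt ℝ ∞ R z.2 ∧ deriv R z.2 = κ z.2 :=
    continuousAt_snd.eventually hR
  let w : ℝ × ℝ → V := fun z ↦ u z - R z.2 • N z
  have hwN : ∀ᶠ z in 𝓝 z₀, ContDiffAt ℝ ∞ (fun z ↦ (w z, N z)) z := by
    filter_upwards [h, hR'] with z hz hRz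
    exact (hz.contDiffAt_offset hRz.1).prodMk hz.contDiffAt_normal
  have hd : ∀ {z}, ContDiffAt ℝ ∞ (fun z ↦ (w z, N z)) z → ∀ v,
      fderiv ℝ (fun z ↦ (w z, N z)) z v = (fderiv ℝ w z v, fderiv ℝ N z v) := fun hz v ↦
    DFunLike.congr_fun ((hz.fst.differentiableAt (by simp)).fderiv_prodMk
      (hz.snd.differentiableAt (by simp))) v
  have hker : ∀ᶠ z in 𝓝 z₀, ∃ a : ℝ, fderiv ℝ (fun z ↦ (w z, N z)) z (-a, 1) = 0 := by
    filter_upwards [h.eventually_nhds, hR', hwN] with z hz hRz hwNz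
    obtain ⟨a, hu, hN⟩ := exists_fderiv_eq hV hz
    refine ⟨a, ?_⟩
    rw [hd hwNz, hN, hz.self_of_nhds.fderiv_offset_apply_neg_one
      (hRz.1.differentiableAt (by simp)) hRz.2 hu hN, Prod.mk_zero_zero]
  have hw₀ : fderiv ℝ w z₀ (1, 0) = fderiv ℝ u z₀ (1, 0) := by
    rw [h.self_of_nhds.fderiv_offset (hR.self_of_nhds.1.differentiableAt (by simp))
      hR.self_of_nhds.2]
    simp [hR₀]
  let ℓ : V →L[ℝ] ℝ := innerSL ℝ (fderiv ℝ u z₀ (1, 0))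
  obtain ⟨φ, hmem, hφ, hφs⟩ := exists_straightening hwN hker (ℓ ∘L .fst ℝ V V) (by
    rw [hd hwN.self_of_nhds, hw₀]
    simpa [ℓ] using h.self_of_nhds.fderiv_ne_zero)
  refine ⟨φ, ℓ, hmem, hφ, hφs.mono fun z hz ↦ ?_⟩
  exact ⟨hz.1, hz.2.2.1, hz.2.1, Prod.mk.inj hz.2.2.2⟩

lemma IsEquidistantFamilyAt.exists_eq_add_smul_normal (hV : Module.finrank ℝ V = 2)
    {u N : ℝ × ℝ → V} {κ : ℝ → ℝ} {z₀ : ℝ × ℝ}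
    (h : ∀ᶠ z in 𝓝 z₀, IsEquidistantFamilyAt u N κ z) :
    ∃ (φ : OpenPartialHomeomorph (ℝ × ℝ) (ℝ × ℝ)) (c n : ℝ → V) (R : ℝ → ℝ),
      z₀ ∈ φ.source ∧ (φ z₀).2 = z₀.2 ∧
      (∀ᶠ t in 𝓝 z₀.2, ContDiffAt ℝ ∞ R t ∧ deriv R t = κ t) ∧
      (∀ᶠ s in 𝓝 (φ z₀).1, IsFramedCurveAt c n s) ∧
      ∀ᶠ z in 𝓝 (φ z₀), (φ.symm z).2 = z.2 ∧ u (φ.symm z) = c z.1 + R z.2 • n z.1 := by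
  have hκ : ∀ᶠ t in 𝓝 z₀.2, ContDiffAt ℝ ∞ κ t :=
    (Continuous.prodMk_right z₀.1).continuousAt.eventually (h.mono fun z hz ↦ hz.contDiffAt_speed)
  obtain ⟨R, hR₀, hR⟩ := exists_smooth_primitive hκ
  obtain ⟨φ, ℓ, hmem, hφ, hφs⟩ := IsEquidistantFamilyAt.exists_straightening_offset hV h hR₀ hR
  let ψ : ℝ → ℝ × ℝ := fun s ↦ φ.symm (s, (φ z₀).2)
  have hline : Filter.Tendsto (fun s ↦ (s, (φ z₀).2)) (𝓝 (φ z₀).1) (𝓝 (φ z₀)) :=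
    (Continuous.prodMk_left (φ z₀).2).continuousAt
  refine ⟨φ, fun s ↦ u (ψ s) - R (ψ s).2 • N (ψ s), fun s ↦ N (ψ s), R, hmem, hφ, hR, ?_, ?_⟩
  · have hℓ := hline.eventually (hφs.mono fun z hz ↦ hz.2.2.1)
    filter_upwards [hline.eventually hφs, hℓ.eventually_nhds,
      hline.eventually ((φ.eventually_nhds' _ hmem).2 (h.eventually_nhds.and
        (continuousAt_snd.eventually hR)))] with s hs hℓs ⟨hus, hRs⟩
    exact IsEquidistantFamilyAt.isFramedCurveAt hus hRs.1 hRs.2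
      (hs.1.comp s (by fun_prop)) hℓs
  · filter_upwards [hφs] with z ⟨_, hsnd, _, hw, hN⟩
    refine ⟨hsnd, ?_⟩
    rw [← hw, ← hN, ← hsnd, sub_add_cancel]

end EquidistantFamilies

section Tubes

lemma mem_normalSpace {c : ℝ → R4} {s : ℝ} {x : R4} :
    x ∈ normalSpace c s ↔ ⟪deriv c s, x⟫ = 0 :=
  Submodule.mem_orthogonal_singleton_iff_inner_right

lemma IsNormalParallel.inner_sub_deriv_sub {c ξ ζ : ℝ → R4} {J : Set ℝ} {s : ℝ}
    (hξ : IsNormalParallel c J ξ) (hζ : IsNormalParallel c J ζ) (hs : s ∈ J) :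
    ⟪ξ s - ζ s, deriv ξ s - deriv ζ s⟫ = 0 := by
  have hparallel : deriv ξ s - deriv ζ s ∈ (normalSpace c s)ᗮ := by
    rw [← Submodule.starProjection_apply_eq_zero_iff, map_sub, hξ.parallel s hs,
      hζ.parallel s hs, sub_zero]
  exact hparallel _ (Submodule.sub_mem _ (hξ.normal s hs) (hζ.normal s hs))

lemma IsNormalParallel.eqOn {c ξ ζ : ℝ → R4} {J : Set ℝ} {s₀ : ℝ} (hJ : IsOpen J)
    (hJ' : IsPreconnected J) (hs₀ : s₀ ∈ J) (hξ : IsNormalParallel c J ξ)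
    (hζ : IsNormalParallel c J ζ) (h : ξ s₀ = ζ s₀) : EqOn ξ ζ J := by
  have hd : ∀ s ∈ J, HasDerivAt (fun s ↦ ⟪ξ s - ζ s, ξ s - ζ s⟫) 0 s := by
    intro s hs
    have hsub := (hξ.differentiableAt s hs).hasDerivAt.fun_sub
      (hζ.differentiableAt s hs).hasDerivAt
    refine (hsub.inner ℝ hsub).congr_deriv ?_
    rw [real_inner_comm (ξ s - ζ s), hξ.inner_sub_deriv_sub hζ hs, add_zero]
  intro s hs
  have hconst := hJ.is_const_of_deriv_eq_zero hJ'
    (fun s hs ↦ (hd s hs).differentiableAt.differentiableWithinAt) (fun s hs ↦ (hd s hs).deriv)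
    hs hs₀
  simp only [h, sub_self, inner_zero_left] at hconst
  exact sub_eq_zero.1 (inner_self_eq_zero.1 hconst)

lemma IsNormalParallel.holonomyTube_eq {c ξ : ℝ → R4} {J : Set ℝ} {s₀ : ℝ}
    (hξ : IsNormalParallel c J ξ) (hJ : IsOpen J) (hJ' : IsPreconnected J) (hs₀ : s₀ ∈ J) :
    holonomyTube c J s₀ (ξ s₀) = (fun s ↦ c s + ξ s) '' J := by
  ext q
  constructor
  · rintro ⟨ζ, hζ, h, s, hs, rfl⟩
    exact ⟨s, hs, by simp only [hξ.eqOn hJ hJ' hs₀ hζ h.symm hs]⟩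
  · rintro ⟨s, hs, rfl⟩
    exact ⟨ξ, hξ, rfl, s, hs, rfl⟩

section Slope

variable {E : Type*} [NormedAddCommGroup E] [InnerProductSpace ℝ E] {n b : E} {v θ : ℝ}

lemma norm_mul_cos_smul_add (hn : ‖n‖ = 1) (hnb : ⟪n, b⟫ = 0) (hv : 0 ≤ v)
    (hb : ‖b‖ = v * Real.sin θ) : ‖(v * Real.cos θ) • n + b‖ = v := by
  rw [← sq_eq_sq₀ (norm_nonneg _) hv, norm_add_sq_real, inner_smul_left, hnb, norm_smul, hn, hb]
  simp only [Real.norm_eq_abs, mul_one, sq_abs, mul_zero, add_zero]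
  linear_combination v ^ 2 * Real.sin_sq_add_cos_sq θ

lemma angle_mul_cos_smul_add (hn : ‖n‖ = 1) (hnb : ⟪n, b⟫ = 0) (hv : 0 < v)
    (hb : ‖b‖ = v * Real.sin θ) (hθ₀ : 0 ≤ θ) (hθ : θ ≤ Real.pi) :
    InnerProductGeometry.angle ((v * Real.cos θ) • n + b) n = θ := by
  have hinner : ⟪(v * Real.cos θ) • n + b, n⟫ = v * Real.cos θ := by
    rw [inner_add_left, inner_smul_left, real_inner_comm n b, hnb, real_inner_self_eq_norm_sq, hn]
    simp
  rw [InnerProductGeometry.angle, hinner, norm_mul_cos_smul_add hn hnb hv.le hb, hn, mul_one,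
    mul_div_cancel_left₀ _ hv.ne', Real.arccos_cos hθ₀ hθ]

end Slope

/-- The curves `r ↦ R r • n + β r`, with `n` a unit vector of `P`, are smooth at `t`, and their
velocity there is nonzero and makes the angle `θ` with `n`; `v` is the speed. -/
structure IsHelixProfileAt {E : Type*} [NormedAddCommGroup E] [InnerProductSpace ℝ E]
    {P : Submodule ℝ E} (θ : ℝ) (R : ℝ → ℝ) (β : ℝ → Pᗮ) (t : ℝ) : Prop where
  contDiffAt_radius : ContDiffAt ℝ ∞ R t
  contDiffAt_normal : ContDiffAt ℝ ∞ β t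
  exists_speed : ∃ v : ℝ, 0 < v ∧ deriv R t = v * Real.cos θ ∧ ‖deriv β t‖ = v * Real.sin θ

variable {P : Submodule ℝ R4}

lemma IsHelixProfileAt.isHelix {θ : ℝ} (hθ₀ : 0 ≤ θ) (hθ : θ ≤ Real.pi) {R : ℝ → ℝ} {β : ℝ → Pᗮ}
    {K : Set ℝ} (h : ∀ t ∈ K, IsHelixProfileAt θ R β t) {n : P} (hn : ‖n‖ = 1) :
    IsHelix (fun t ↦ R t • (n : R4) + β t) K n θ := by
  have hd : ∀ t ∈ K, HasDerivAt (fun t ↦ R t • (n : R4) + β t)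
      (deriv R t • (n : R4) + (deriv β t : Pᗮ)) t := fun t ht ↦
    (((h t ht).contDiffAt_radius.differentiableAt (by simp)).hasDerivAt.smul_const _).add
      (hasDerivAt_subtype_coe ((h t ht).contDiffAt_normal.differentiableAt (by simp)).hasDerivAt)
  have hn' : ‖(n : R4)‖ = 1 := hn
  have hinner : ∀ t, ⟪(n : R4), (deriv β t : Pᗮ)⟫ = 0 := fun t ↦ (deriv β t).2 n n.2
  refine ⟨⟨fun t ht ↦ ContDiffAt.contDiffWithinAt ?_, fun t ht ↦ ?_⟩, fun t ht ↦ ?_⟩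
  · exact ((h t ht).contDiffAt_radius.smul contDiffAt_const).add
      (Pᗮ.subtypeL.contDiff.contDiffAt.comp t (h t ht).contDiffAt_normal)
  all_goals
    obtain ⟨v, hv, hR, hβ⟩ := (h t ht).exists_speed
    rw [(hd t ht).deriv, hR]
  · rw [← norm_pos_iff, norm_mul_cos_smul_add hn' (hinner t) hv.le hβ]
    exact hv
  · exact angle_mul_cos_smul_add hn' (hinner t) hv hβ hθ₀ hθ

lemma IsFramedCurveAt.exists_deriv_normal_eq {V : Type*} [NormedAddCommGroup V]
    [InnerProductSpace ℝ V] (hV : Module.finrank ℝ V = 2) {c n : ℝ → V} {s : ℝ}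
    (h : ∀ᶠ r in 𝓝 s, IsFramedCurveAt c n r) : ∃ k : ℝ, deriv n s = k • deriv c s := by
  have hs := h.self_of_nhds
  have hnn : ⟪n s, deriv n s⟫ = 0 :=
    inner_fderiv_eq_zero_of_norm_eq_one hs.differentiableAt_normal
      (h.mono fun r hr ↦ hr.norm_eq_one) 1
  exact exists_eq_smul_of_inner_eq_zero hV (norm_ne_zero_iff.1 (by simp [hs.norm_eq_one]))
    hs.deriv_ne_zero ((real_inner_comm _ _).trans hs.inner_eq_zero) hnn

lemma IsFramedCurveAt.isNormalParallel (hP : Module.finrank ℝ P = 2) {c n : ℝ → P} {J : Set ℝ}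
    (hJ : IsOpen J) (h : ∀ s ∈ J, IsFramedCurveAt c n s) (r : ℝ) (b : Pᗮ) :
    IsNormalParallel (fun s ↦ (c s : R4)) J fun s ↦ r • (n s : R4) + b := by
  have hc : ∀ s ∈ J, deriv (fun s ↦ (c s : R4)) s = (deriv c s : P) := fun s hs ↦
    (hasDerivAt_subtype_coe ((h s hs).contDiffAt.differentiableAt (by simp)).hasDerivAt).deriv
  have hd : ∀ s ∈ J, HasDerivAt (fun s ↦ r • (n s : R4) + b) (r • (deriv n s : P)) s :=
    fun s hs ↦ ((hasDerivAt_subtype_coe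
      (h s hs).differentiableAt_normal.hasDerivAt).const_smul r).add_const _
  refine ⟨fun s hs ↦ ?_, fun s hs ↦ (hd s hs).differentiableAt, fun s hs ↦ ?_⟩
  · rw [mem_normalSpace, hc s hs, inner_add_right, inner_smul_right, b.2 _ (deriv c s).2,
      ← P.coe_inner, (h s hs).inner_eq_zero, mul_zero, add_zero]
  · obtain ⟨k, hk⟩ := IsFramedCurveAt.exists_deriv_normal_eq hP
      (Filter.eventually_of_mem (hJ.mem_nhds hs) h)
    rw [(hd s hs).deriv, hk, Submodule.starProjection_apply_eq_zero_iff, normalSpace,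
      Submodule.orthogonal_orthogonal, Submodule.mem_span_singleton, hc s hs]
    exact ⟨r * k, by rw [mul_smul, P.coe_smul]⟩

lemma isUnionOfHolonomyTubes_image (hP : Module.finrank ℝ P = 2) {θ : ℝ} (hθ₀ : 0 ≤ θ)
    (hθ : θ ≤ Real.pi) {c n : ℝ → P} {R : ℝ → ℝ} {β : ℝ → Pᗮ} {a b a' b' : ℝ} (hab : a < b)
    (hab' : a' < b') (hc : ∀ s ∈ Ioo a b, IsFramedCurveAt c n s)
    (hβ : ∀ t ∈ Ioo a' b', IsHelixProfileAt θ R β t) :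
    IsUnionOfHolonomyTubes P θ ((fun z : ℝ × ℝ ↦ (c z.1 + (R z.2 • (n z.1 : R4) + β z.2) : R4)) ''
      (Ioo a b ×ˢ Ioo a' b')) := by
  obtain ⟨s₀, hs₀⟩ := nonempty_Ioo.2 hab
  have hpar := IsFramedCurveAt.isNormalParallel hP isOpen_Ioo hc
  have hcd : ∀ s ∈ Ioo a b, deriv (fun s ↦ (c s : R4)) s = (deriv c s : P) := fun s hs ↦
    (hasDerivAt_subtype_coe ((hc s hs).contDiffAt.differentiableAt (by simp)).hasDerivAt).deriv
  refine ⟨fun s ↦ c s, fun t ↦ R t • (n s₀ : R4) + β t, a, b, s₀, a', b', n s₀, hs₀, hab',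
    ⟨fun s hs ↦ ?_, fun s hs ↦ ?_⟩, fun s _ ↦ (c s).2, (n s₀).2, (hc s₀ hs₀).norm_eq_one, ?_,
    fun t _ ↦ (hpar (R t) (β t)).normal s₀ hs₀,
    IsHelixProfileAt.isHelix hθ₀ hθ hβ (hc s₀ hs₀).norm_eq_one, ?_⟩
  · exact (P.subtypeL.contDiff.contDiffAt.comp s (hc s hs).contDiffAt).contDiffWithinAt
  · rw [hcd s hs]
    simpa using (hc s hs).deriv_ne_zero
  · rw [mem_normalSpace, hcd s₀ hs₀]
    exact (hc s₀ hs₀).inner_eq_zero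
  · rw [prod_eq_biUnion_right]
    simp only [image_iUnion, image_image]
    refine iUnion₂_congr fun t _ ↦ ?_
    exact ((hpar (R t) (β t)).holonomyTube_eq isOpen_Ioo isPreconnected_Ioo hs₀).symm

end Tubes

section LocalForm

variable {E X Y : Type*} [NormedAddCommGroup E] [InnerProductSpace ℝ E] [TopologicalSpace X]
  [TopologicalSpace Y] {θ : ℝ}

/-- In suitable coordinates `(s, t)` around `x`, the map `F` is `c s + R t • n s + β t` for a plane
curve `c` with unit normal `n` and a profile `(R, β)` of slope `θ`: locally it parametrizes a union
of holonomy tubes. -/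
def IsHolonomyTubularAt (P : Submodule ℝ E) (θ : ℝ) (F : X → E) (x : X) : Prop :=
  ∃ (φ : OpenPartialHomeomorph X (ℝ × ℝ)) (c n : ℝ → P) (R : ℝ → ℝ) (β : ℝ → Pᗮ), x ∈ φ.source ∧
    (∀ᶠ s in 𝓝 (φ x).1, IsFramedCurveAt c n s) ∧
    (∀ᶠ t in 𝓝 (φ x).2, IsHelixProfileAt θ R β t) ∧
    ∀ᶠ z in 𝓝 (φ x), F (φ.symm z) = c z.1 + (R z.2 • (n z.1 : E) + β z.2)

lemma IsHolonomyTubularAt.of_comp_symm {P : Submodule ℝ E} {F : X → E}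
    (ψ : OpenPartialHomeomorph X Y) {x : X} (hx : x ∈ ψ.source)
    (h : IsHolonomyTubularAt P θ (F ∘ ψ.symm) (ψ x)) :
    IsHolonomyTubularAt P θ F x := by
  obtain ⟨φ, c, n, R, β, hφ, hc, hβ, hF⟩ := h
  exact ⟨ψ.trans φ, c, n, R, β, by simp [hx, hφ], hc, hβ, hF⟩

lemma IsHolonomyTubularAt.exists_isUnionOfHolonomyTubes {P : Submodule ℝ R4}
    (hP : Module.finrank ℝ P = 2) (hθ₀ : 0 ≤ θ) (hθ : θ ≤ Real.pi) {F : X → R4}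
    {x : X} (h : IsHolonomyTubularAt P θ F x) {W : Set X} (hW : W ∈ 𝓝 x) :
    ∃ U ⊆ W, IsOpen U ∧ x ∈ U ∧ IsUnionOfHolonomyTubes P θ (F '' U) := by
  obtain ⟨φ, c, n, R, β, hx, hc, hβ, hF⟩ := h
  obtain ⟨ε, hε, hball⟩ := Metric.eventually_nhds_iff_ball.1
    ((φ.open_target.eventually_mem (φ.map_source hx)).and (((φ.eventually_nhds' _ hx).2 hW).and
      ((continuousAt_fst.eventually hc).and ((continuousAt_snd.eventually hβ).and hF))))
  have hmem : φ x ∈ Metric.ball (φ x) ε := Metric.mem_ball_self hε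
  refine ⟨φ.symm '' Metric.ball (φ x) ε, ?_, ?_, ⟨φ x, hmem, φ.left_inv hx⟩, ?_⟩
  · exact image_subset_iff.2 fun z hz ↦ (hball z hz).2.1
  · exact φ.symm.isOpen_image_of_subset_source Metric.isOpen_ball fun z hz ↦ (hball z hz).1
  · rw [image_image, image_congr fun z hz ↦ (hball z hz).2.2.2.2]
    rw [← ball_prod_same, Real.ball_eq_Ioo, Real.ball_eq_Ioo] at hball ⊢
    rw [← ball_prod_same, Real.ball_eq_Ioo, Real.ball_eq_Ioo] at hmem
    exact isUnionOfHolonomyTubes_image hP hθ₀ hθ (hmem.1.1.trans hmem.1.2)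
      (hmem.2.1.trans hmem.2.2) (fun s hs ↦ (hball (s, _) ⟨hs, hmem.2⟩).2.2.1)
      (fun t ht ↦ (hball (_, t) ⟨hmem.1, ht⟩).2.2.2.1)

end LocalForm

section Inclined

variable {E X Y : Type*} [NormedAddCommGroup E] [InnerProductSpace ℝ E]
  [NormedAddCommGroup X] [NormedSpace ℝ X] [NormedAddCommGroup Y] [NormedSpace ℝ Y]
  {P : Submodule ℝ E} {θ : ℝ}

/-- `F` is a smooth immersion near `x` whose tangent space at `x` is a plane that has the principal
angles `0` and `θ` with the plane `P`. -/
structure IsInclinedImmersionAt (P : Submodule ℝ E) (θ : ℝ) (F : X → E) (x : X) : Prop where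
  contDiffAt : ContDiffAt ℝ ∞ F x
  injective_fderiv : Function.Injective (fderiv ℝ F x)
  exists_isPrincipalBasis :
    ∃ e w η, IsPrincipalBasis (LinearMap.range (fderiv ℝ F x).toLinearMap) P θ e w η

namespace IsInclinedImmersionAt

lemma differentiableAt {F : X → E} {x : X} (h : IsInclinedImmersionAt P θ F x) :
    DifferentiableAt ℝ F x :=
  h.contDiffAt.differentiableAt (by simp)

lemma comp [FiniteDimensional ℝ X] [FiniteDimensional ℝ Y]
    (hXY : Module.finrank ℝ X = Module.finrank ℝ Y) {F : X → E} {ψ : Y → X} {y : Y}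
    (h : IsInclinedImmersionAt P θ F (ψ y)) (hψ : ContDiffAt ℝ ∞ ψ y)
    (hinj : Function.Injective (fderiv ℝ ψ y)) : IsInclinedImmersionAt P θ (F ∘ ψ) y := by
  have hd : fderiv ℝ (F ∘ ψ) y = (fderiv ℝ F (ψ y)).comp (fderiv ℝ ψ y) :=
    fderiv_comp y h.differentiableAt (hψ.differentiableAt (by simp))
  refine ⟨h.contDiffAt.comp y hψ, ?_, ?_⟩
  · rw [hd]
    exact h.injective_fderiv.comp hinj
  · have hsurj : LinearMap.range (fderiv ℝ ψ y).toLinearMap = ⊤ :=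
      LinearMap.range_eq_top.2 ((LinearMap.injective_iff_surjective_of_finrank_eq_finrank
        (f := (fderiv ℝ ψ y).toLinearMap) hXY.symm).1 hinj)
    rw [hd, ContinuousLinearMap.toLinearMap_comp, LinearMap.range_comp_of_range_eq_top _ hsurj]
    exact h.exists_isPrincipalBasis

lemma exists_coordinates [FiniteDimensional ℝ X] (hX : Module.finrank ℝ X = 2) {F : X → E}
    {x : X} (h : ∀ᶠ y in 𝓝 x, IsInclinedImmersionAt P θ F y) {p q : E}
    (hpq : ∀ v, ⟪p, fderiv ℝ F x v⟫ = 0 → ⟪q, fderiv ℝ F x v⟫ = 0 → fderiv ℝ F x v = 0) :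
    ∃ ψ : OpenPartialHomeomorph X (ℝ × ℝ), x ∈ ψ.source ∧ ∀ᶠ z in 𝓝 (ψ x),
      IsInclinedImmersionAt P θ (F ∘ ψ.symm) z ∧ ⟪p, (F ∘ ψ.symm) z⟫ = z.1 ∧
        ⟪q, (F ∘ ψ.symm) z⟫ = z.2 := by
  have hsmooth : ∀ n : E, ∀ᶠ y in 𝓝 x, ContDiffAt ℝ ∞ (fun y ↦ innerSL ℝ n (F y)) y := fun n ↦
    h.mono fun y hy ↦ (innerSL ℝ n).contDiff.contDiffAt.comp y hy.contDiffAt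
  have hF := h.self_of_nhds
  obtain ⟨ψ, -, hx, hψ⟩ := exists_smooth_coordinates hX (hsmooth p) (hsmooth q)
    fun v hp hq ↦ (injective_iff_map_eq_zero _).1 hF.injective_fderiv v (by
      rw [fderiv_clm_comp_apply _ hF.differentiableAt] at hp hq
      exact hpq v hp hq)
  refine ⟨ψ, hx, ?_⟩
  filter_upwards [hψ, (ψ.eventually_nhds' _ hx).2 h] with z ⟨hz, hzp, hzq⟩ hFz
  exact ⟨hFz.comp (by simp [hX]) hz.1 hz.2, hzp, hzq⟩

lemma fderiv_mem_range {F : X → E} {x : X} (v : X) :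
    fderiv ℝ F x v ∈ LinearMap.range (fderiv ℝ F x).toLinearMap :=
  ⟨v, rfl⟩

lemma fderiv_mem_of_eq_zero {F : X → E} {x : X} (h : IsInclinedImmersionAt P 0 F x) (v : X) :
    fderiv ℝ F x v ∈ P := by
  obtain ⟨e, w, η, hb⟩ := h.exists_isPrincipalBasis
  exact hb.le_of_eq_zero (fderiv_mem_range v)

lemma fderiv_one_zero_mem {F : ℝ × ℝ → E} {ν : E} {z : ℝ × ℝ} (hν : ν ∈ Pᗮ)
    (hF : IsInclinedImmersionAt P θ F z) (hz : ∀ᶠ z in 𝓝 z, ⟪ν, F z⟫ = z.2) :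
    fderiv ℝ F z (1, 0) ∈ P ∧ ⟪ν, fderiv ℝ F z (0, 1)⟫ = 1 := by
  have hd : ∀ v, ⟪ν, fderiv ℝ F z v⟫ = v.2 := fun v ↦ by
    have heq : (fun z ↦ innerSL ℝ ν (F z)) =ᶠ[𝓝 z] Prod.snd := hz
    have hlin := fderiv_clm_comp_apply (innerSL ℝ ν) hF.differentiableAt v
    rw [heq.fderiv_eq, fderiv_snd] at hlin
    exact hlin.symm
  obtain ⟨e, w, η, hb⟩ := hF.exists_isPrincipalBasis
  exact ⟨hb.mem_of_inner_eq_zero hν (fderiv_mem_range _) (fderiv_mem_range (0, 1)) (hd _)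
    (by simp [hd]), hd _⟩

variable [P.HasOrthogonalProjection]

lemma eventually_orthogonalProjectionOnto_orthogonal_eq {F : X → E} {x : X}
    (h : ∀ᶠ y in 𝓝 x, IsInclinedImmersionAt P 0 F y) :
    ∀ᶠ y in 𝓝 x, Pᗮ.orthogonalProjectionOnto (F y) = Pᗮ.orthogonalProjectionOnto (F x) :=
  eventually_eq_of_fderiv_eq_zero <| h.mono fun y hy ↦
    ⟨Pᗮ.orthogonalProjectionOnto.differentiableAt.comp y hy.differentiableAt, by
      ext1 v
      rw [fderiv_clm_comp_apply _ hy.differentiableAt, zero_apply,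
        Submodule.orthogonalProjectionOnto_orthogonal_apply_eq_zero (hy.fderiv_mem_of_eq_zero v)]⟩

/-- An inclined immersion of slope zero lies in a plane parallel to `P`. Cartesian coordinates of
that plane exhibit it as a union of parallel lines. -/
lemma isHolonomyTubularAt_zero [FiniteDimensional ℝ X] (hX : Module.finrank ℝ X = 2)
    (hP : Module.finrank ℝ P = 2) {F : X → E} {x : X}
    (h : ∀ᶠ y in 𝓝 x, IsInclinedImmersionAt P 0 F y) : IsHolonomyTubularAt P 0 F x := by
  have : FiniteDimensional ℝ P := Module.finite_of_finrank_pos (by lia)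
  let b : OrthonormalBasis (Fin 2) ℝ P := (stdOrthonormalBasis ℝ P).reindex (finCongr hP)
  have hb : ∀ a : E,
      P.orthogonalProjectionOnto a = ⟪(b 0 : E), a⟫ • b 0 + ⟪(b 1 : E), a⟫ • b 1 := fun a ↦ by
    rw [← b.sum_repr' (P.orthogonalProjectionOnto a), Fin.sum_univ_two,
      Submodule.inner_orthogonalProjectionOnto_eq_of_mem_left,
      Submodule.inner_orthogonalProjectionOnto_eq_of_mem_left]
  obtain ⟨ψ, hx, hψ⟩ := exists_coordinates hX h (p := b 0) (q := b 1) fun v hv₀ hv₁ ↦ by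
    have hv := P.orthogonalProjectionOnto_mem_subspace_eq_self
      ⟨_, h.self_of_nhds.fderiv_mem_of_eq_zero v⟩
    rw [hb, hv₀, hv₁, zero_smul, zero_smul, add_zero] at hv
    exact congrArg Subtype.val hv.symm
  refine IsHolonomyTubularAt.of_comp_symm ψ hx ⟨.refl _, fun s ↦ s • b 0, fun _ ↦ b 1, id,
    fun _ ↦ Pᗮ.orthogonalProjectionOnto (F x), mem_univ _, .of_forall fun s ↦ ?_,
    .of_forall fun t ↦ ⟨contDiffAt_id, contDiffAt_const, 1, one_pos, by simp, by simp⟩, ?_⟩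
  · have hd : HasDerivAt (fun s : ℝ ↦ s • b 0) (b 0) s := by
      simpa using (hasDerivAt_id s).smul_const (b 0)
    refine ⟨by fun_prop, by fun_prop, ?_, b.norm_eq_one 1, ?_⟩
    all_goals rw [hd.deriv]
    · exact b.orthonormal.ne_zero 0
    · exact b.inner_eq_zero zero_ne_one
  · filter_upwards [hψ, (ψ.eventually_nhds' _ hx).2
      (eventually_orthogonalProjectionOnto_orthogonal_eq h)] with z ⟨_, hz₀, hz₁⟩ hz
    have hsplit := P.starProjection_add_starProjection_orthogonal ((F ∘ ψ.symm) z)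
    rw [Submodule.starProjection_apply, Submodule.starProjection_apply, hb, hz₀, hz₁,
      Function.comp_apply, hz, Submodule.coe_add, add_assoc] at hsplit
    exact hsplit.symm

variable {F : ℝ × ℝ → E} {ν : E} {z z₀ : ℝ × ℝ}

lemma exists_orthogonalProjectionOnto_eq (hν : ν ∈ Pᗮ)
    (h : ∀ᶠ z in 𝓝 z₀, IsInclinedImmersionAt P θ F z ∧ ⟪ν, F z⟫ = z.2) :
    ∃ β : ℝ → Pᗮ, ∀ᶠ z in 𝓝 z₀, Pᗮ.orthogonalProjectionOnto (F z) = β z.2 ∧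
      ContDiffAt ℝ ∞ β z.2 ∧ deriv β z.2 ≠ 0 ∧
      Pᗮ.orthogonalProjectionOnto (fderiv ℝ F z (0, 1)) = deriv β z.2 := by
  have hline : Filter.Tendsto (fun z : ℝ × ℝ ↦ (z₀.1, z.2)) (𝓝 z₀) (𝓝 z₀) :=
    Continuous.tendsto' (by fun_prop) _ _ rfl
  have hhor : ∀ᶠ z in 𝓝 z₀, fderiv ℝ F z (1, 0) ∈ P ∧ ⟪ν, fderiv ℝ F z (0, 1)⟫ = 1 :=
    h.eventually_nhds.mono fun z hz ↦
      fderiv_one_zero_mem hν hz.self_of_nhds.1 (hz.mono fun _ h ↦ h.2)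
  have hβ : ∀ᶠ z in 𝓝 z₀, Pᗮ.orthogonalProjectionOnto (F z) =
      Pᗮ.orthogonalProjectionOnto (F (z₀.1, z.2)) := by
    refine eventually_eq_of_fderiv_one_zero (g := fun z ↦ Pᗮ.orthogonalProjectionOnto (F z)) ?_
    filter_upwards [h, hhor] with z hz hz'
    exact ⟨Pᗮ.orthogonalProjectionOnto.differentiableAt.comp z hz.1.differentiableAt, by
      rw [fderiv_clm_comp_apply _ hz.1.differentiableAt,
        Submodule.orthogonalProjectionOnto_orthogonal_apply_eq_zero hz'.1]⟩
  refine ⟨fun t ↦ Pᗮ.orthogonalProjectionOnto (F (z₀.1, t)), ?_⟩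
  filter_upwards [hβ.eventually_nhds, h, hhor, hline.eventually h] with z hz hFz hz' hFz₀
  have hs : ContDiffAt ℝ ∞ (fun t ↦ Pᗮ.orthogonalProjectionOnto (F (z₀.1, t))) z.2 :=
    Pᗮ.orthogonalProjectionOnto.contDiff.contDiffAt.comp z.2
      (hFz₀.1.contDiffAt.comp z.2 (by fun_prop))
  have hd : Pᗮ.orthogonalProjectionOnto (fderiv ℝ F z (0, 1)) =
      deriv (fun t ↦ Pᗮ.orthogonalProjectionOnto (F (z₀.1, t))) z.2 := by
    have hcomp : (fun z ↦ Pᗮ.orthogonalProjectionOnto (F z)) =ᶠ[𝓝 z]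
        (fun t ↦ Pᗮ.orthogonalProjectionOnto (F (z₀.1, t))) ∘ Prod.snd := hz
    rw [← fderiv_clm_comp_apply _ hFz.1.differentiableAt, hcomp.fderiv_eq,
      fderiv_comp z (hs.differentiableAt (by simp)) differentiableAt_snd]
    simp [fderiv_snd]
  refine ⟨hz.self_of_nhds, hs, fun h₀ ↦ ?_, hd⟩
  have hinner := Submodule.inner_orthogonalProjectionOnto_eq_of_mem_left (K := Pᗮ) ⟨ν, hν⟩
    (fderiv ℝ F z (0, 1))
  rw [hd, h₀, inner_zero_right, hz'.2] at hinner
  exact zero_ne_one hinner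

lemma fderiv_orthogonalProjectionOnto (hF : IsInclinedImmersionAt P θ F z) (v : ℝ × ℝ) :
    fderiv ℝ (fun z ↦ P.orthogonalProjectionOnto (F z)) z v =
      P.orthogonalProjectionOnto (fderiv ℝ F z v) :=
  fderiv_clm_comp_apply _ hF.differentiableAt v

lemma contDiffAt_fderiv_orthogonalProjectionOnto (hF : IsInclinedImmersionAt P θ F z)
    (v : ℝ × ℝ) :
    ContDiffAt ℝ ∞ (fun z ↦ fderiv ℝ (fun z ↦ P.orthogonalProjectionOnto (F z)) z v) z :=
  ((P.orthogonalProjectionOnto.contDiff.contDiffAt.comp z hF.contDiffAt).fderiv_right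
    (by simp)).clm_apply contDiffAt_const

lemma coe_fderiv_orthogonalProjectionOnto (hF : IsInclinedImmersionAt P θ F z) {v : ℝ × ℝ}
    (hv : fderiv ℝ F z v ∈ P) :
    (fderiv ℝ (fun z ↦ P.orthogonalProjectionOnto (F z)) z v : E) = fderiv ℝ F z v := by
  rw [hF.fderiv_orthogonalProjectionOnto]
  exact congrArg Subtype.val (P.orthogonalProjectionOnto_mem_subspace_eq_self ⟨_, hv⟩)

lemma fderiv_orthogonalProjectionOnto_ne_zero (hF : IsInclinedImmersionAt P θ F z) {v : ℝ × ℝ}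
    (hv : fderiv ℝ F z v ∈ P) (hv₀ : v ≠ 0) :
    fderiv ℝ (fun z ↦ P.orthogonalProjectionOnto (F z)) z v ≠ 0 := fun h₀ ↦ by
  have hFv := hF.coe_fderiv_orthogonalProjectionOnto hv
  rw [h₀, Submodule.coe_zero, eq_comm, map_eq_zero_iff _ hF.injective_fderiv] at hFv
  exact hv₀ hFv

lemma abs_inner_fderiv_orthogonalProjectionOnto (hP : Module.finrank ℝ P = 2)
    (hsin : 0 < Real.sin θ) (hcos : 0 ≤ Real.cos θ) (hF : IsInclinedImmersionAt P θ F z)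
    {v : ℝ × ℝ} (hv : fderiv ℝ F z v ∈ P) (hv₀ : v ≠ 0) {n : P} (hn : ‖n‖ = 1)
    (hnv : ⟪n, fderiv ℝ (fun z ↦ P.orthogonalProjectionOnto (F z)) z v⟫ = 0) (a : ℝ × ℝ) :
    |⟪n, fderiv ℝ (fun z ↦ P.orthogonalProjectionOnto (F z)) z a⟫| =
      Real.cos θ / Real.sin θ * ‖Pᗮ.orthogonalProjectionOnto (fderiv ℝ F z a)‖ := by
  obtain ⟨e, w, η, hb⟩ := hF.exists_isPrincipalBasis
  rw [div_mul_eq_mul_div, eq_div_iff hsin.ne', hF.fderiv_orthogonalProjectionOnto]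
  exact hb.abs_inner_mul_sin hP hsin hcos
    ((hF.coe_fderiv_orthogonalProjectionOnto hv).symm ▸ fderiv_mem_range v)
    (hF.fderiv_orthogonalProjectionOnto_ne_zero hv hv₀) hn hnv (fderiv_mem_range a)

/-- As the angle is constant, the speed `‖deriv β t‖` of the component in `Pᗮ` determines the normal
speed of the projections to `P`. -/
lemma exists_isEquidistantFamilyAt (hP : Module.finrank ℝ P = 2) (hsin : 0 < Real.sin θ)
    (hcos : 0 ≤ Real.cos θ) {β : ℝ → Pᗮ}
    (h : ∀ᶠ z in 𝓝 z₀, IsInclinedImmersionAt P θ F z ∧ fderiv ℝ F z (1, 0) ∈ P)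
    (hβ : ∀ᶠ z in 𝓝 z₀, ContDiffAt ℝ ∞ β z.2 ∧ deriv β z.2 ≠ 0 ∧
      Pᗮ.orthogonalProjectionOnto (fderiv ℝ F z (0, 1)) = deriv β z.2) :
    ∃ N : ℝ × ℝ → P, ∀ᶠ z in 𝓝 z₀, IsEquidistantFamilyAt
      (fun z ↦ P.orthogonalProjectionOnto (F z)) N
      (fun t ↦ Real.cos θ / Real.sin θ * ‖deriv β t‖) z := by
  have hne : ((1, 0) : ℝ × ℝ) ≠ 0 := by simp
  obtain ⟨N, hN⟩ := exists_contDiffAt_unit_normal (m := ∞) hP fun z ↦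
    fderiv ℝ (fun z ↦ P.orthogonalProjectionOnto (F z)) z (1, 0)
  replace hN : ∀ᶠ z in 𝓝 z₀, _ := h.mono fun z hz ↦
    hN z (hz.1.contDiffAt_fderiv_orthogonalProjectionOnto _)
      (hz.1.fderiv_orthogonalProjectionOnto_ne_zero hz.2 hne)
  have habs : ∀ᶠ z in 𝓝 z₀,
      |⟪N z, fderiv ℝ (fun z ↦ P.orthogonalProjectionOnto (F z)) z (0, 1)⟫| =
        Real.cos θ / Real.sin θ * ‖deriv β z.2‖ := by
    filter_upwards [h, hβ, hN] with z ⟨hz, hz'⟩ ⟨_, _, hβz⟩ ⟨_, hNz, hNu⟩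
    rw [hz.abs_inner_fderiv_orthogonalProjectionOnto hP hsin hcos hz' hne hNz hNu, hβz]
  obtain ⟨σ, hσ, hsign⟩ := exists_sign_mul_eventuallyEq
    (hN.self_of_nhds.1.continuousAt.inner
      (h.self_of_nhds.1.contDiffAt_fderiv_orthogonalProjectionOnto _).continuousAt) habs (by
      rcases eq_or_ne (Real.cos θ) 0 with h₀ | h₀
      · exact .inr (.of_forall fun z ↦ by simp [h₀])
      · exact .inl (mul_ne_zero (div_ne_zero h₀ hsin.ne')
          (norm_ne_zero_iff.2 hβ.self_of_nhds.2.1)))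
  refine ⟨fun z ↦ σ • N z, ?_⟩
  filter_upwards [h, hβ, hN, hsign] with z ⟨hz, hz'⟩ ⟨hβz, hβz', _⟩ ⟨hNs, hNz, hNu⟩ hσz
  refine ⟨P.orthogonalProjectionOnto.contDiff.contDiffAt.comp z hz.contDiffAt,
    hNs.const_smul σ, contDiffAt_const.mul (.norm ℝ ?_ hβz'), ?_,
    hz.fderiv_orthogonalProjectionOnto_ne_zero hz' hne, ?_, ?_⟩
  · exact (hβz.fderiv_right (by simp)).clm_apply contDiffAt_const
  · rw [norm_smul, Real.norm_eq_abs, hσ, hNz, one_mul]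
  · rw [real_inner_smul_left, hNu, mul_zero]
  · rw [real_inner_smul_left, hσz]

lemma isHolonomyTubularAt_of_inner_eq_snd (hP : Module.finrank ℝ P = 2) (hsin : 0 < Real.sin θ)
    (hcos : 0 ≤ Real.cos θ) (hν : ν ∈ Pᗮ)
    (h : ∀ᶠ z in 𝓝 z₀, IsInclinedImmersionAt P θ F z ∧ ⟪ν, F z⟫ = z.2) :
    IsHolonomyTubularAt P θ F z₀ := by
  obtain ⟨β, hβ⟩ := exists_orthogonalProjectionOnto_eq hν h
  obtain ⟨N, hN⟩ := exists_isEquidistantFamilyAt hP hsin hcos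
    (h.eventually_nhds.mono fun z hz ↦ ⟨hz.self_of_nhds.1,
      (fderiv_one_zero_mem hν hz.self_of_nhds.1 (hz.mono fun _ h ↦ h.2)).1⟩)
    (hβ.mono fun _ h ↦ h.2)
  obtain ⟨φ, c, n, R, hz₀, hφz₀, hR, hc, hF⟩ :=
    IsEquidistantFamilyAt.exists_eq_add_smul_normal hP hN
  have hline : Filter.Tendsto (fun t : ℝ ↦ (z₀.1, t)) (𝓝 z₀.2) (𝓝 z₀) :=
    Continuous.tendsto' (by fun_prop) _ _ rfl
  refine ⟨φ, c, n, R, β, hz₀, hc, ?_, ?_⟩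
  · rw [hφz₀]
    filter_upwards [hR, hline.eventually hβ] with t ⟨hRs, hRt⟩ ⟨_, hβs, hβt, _⟩
    refine ⟨hRs, hβs, ‖deriv β t‖ / Real.sin θ, div_pos (norm_pos_iff.2 hβt) hsin, ?_, ?_⟩
    · rw [hRt]
      ring
    · rw [div_mul_cancel₀ _ hsin.ne']
  · filter_upwards [hF, (φ.eventually_nhds' _ hz₀).2 hβ] with z ⟨hz, hzF⟩ ⟨hzβ, _⟩
    have hsplit := P.starProjection_add_starProjection_orthogonal (F (φ.symm z))
    rw [Submodule.starProjection_apply, Submodule.starProjection_apply, hzF, hzβ, hz,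
      Submodule.coe_add, Submodule.coe_smul, add_assoc] at hsplit
    exact hsplit.symm

lemma isHolonomyTubularAt_of_sin_pos [FiniteDimensional ℝ X] (hX : Module.finrank ℝ X = 2)
    (hP : Module.finrank ℝ P = 2) (hsin : 0 < Real.sin θ) (hcos : 0 ≤ Real.cos θ) {F : X → E}
    {x : X} (h : ∀ᶠ y in 𝓝 x, IsInclinedImmersionAt P θ F y) : IsHolonomyTubularAt P θ F x := by
  obtain ⟨e, w, η, hb⟩ := h.self_of_nhds.exists_isPrincipalBasis
  obtain ⟨ψ, hx, hψ⟩ := exists_coordinates hX h fun v hv₀ hv₁ ↦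
    hb.eq_zero_of_inner_eq_zero hsin.ne' (fderiv_mem_range v) hv₀ hv₁
  exact .of_comp_symm ψ hx (isHolonomyTubularAt_of_inner_eq_snd hP hsin hcos hb.mem_orthogonal
    (hψ.mono fun z hz ↦ ⟨hz.1, hz.2.2⟩))

lemma isHolonomyTubularAt [FiniteDimensional ℝ X] (hX : Module.finrank ℝ X = 2)
    (hP : Module.finrank ℝ P = 2) (hθ₀ : 0 ≤ θ) (hθ : θ ≤ Real.pi / 2) {F : X → E} {x : X}
    (h : ∀ᶠ y in 𝓝 x, IsInclinedImmersionAt P θ F y) : IsHolonomyTubularAt P θ F x := by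
  rcases hθ₀.eq_or_lt with rfl | hθpos
  · exact isHolonomyTubularAt_zero hX hP h
  · exact isHolonomyTubularAt_of_sin_pos hX hP
      (Real.sin_pos_of_pos_of_lt_pi hθpos (by linarith [Real.pi_pos]))
      (Real.cos_nonneg_of_neg_pi_div_two_le_of_le (by linarith) hθ) h

end IsInclinedImmersionAt

end Inclined

section ImmersedSurfaces

variable {M : Type*} [TopologicalSpace M] [ChartedSpace (EuclideanSpace ℝ (Fin 2)) M]
  [IsManifold (𝓡 2) ∞ M] {f : M → R4} {x : M} {y : EuclideanSpace ℝ (Fin 2)}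

namespace IsImmersedSurface

lemma contDiffAt_comp_extChartAt_symm (hf : IsImmersedSurface f)
    (hy : y ∈ (extChartAt (𝓡 2) x).target) : ContDiffAt ℝ ∞ (f ∘ (extChartAt (𝓡 2) x).symm) y :=
  (contMDiffOn_iff_contDiffOn.1 (hf.contMDiff.comp_contMDiffOn
    (contMDiffOn_extChartAt_symm x))).contDiffAt ((isOpen_extChartAt_target x).mem_nhds hy)

lemma exists_mfderiv_eq_fderiv_comp (hf : IsImmersedSurface f)
    (hy : y ∈ (extChartAt (𝓡 2) x).target) :
    ∃ A : EuclideanSpace ℝ (Fin 2) ≃L[ℝ] EuclideanSpace ℝ (Fin 2),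
      (show EuclideanSpace ℝ (Fin 2) →L[ℝ] R4 from
        mfderiv (𝓡 2) 𝓘(ℝ, R4) f ((extChartAt (𝓡 2) x).symm y)) =
        (fderiv ℝ (f ∘ (extChartAt (𝓡 2) x).symm) y).comp
          (A : EuclideanSpace ℝ (Fin 2) →L[ℝ] EuclideanSpace ℝ (Fin 2)) := by
  have : IsManifold (𝓡 2) 1 M := IsManifold.of_le (n := ∞) (by simp)
  set φ := extChartAt (𝓡 2) x
  have hys : φ.symm y ∈ φ.source := φ.map_target hy
  have hφy : φ (φ.symm y) = y := φ.right_inv hy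
  have hF : MDifferentiableAt 𝓘(ℝ, EuclideanSpace ℝ (Fin 2)) 𝓘(ℝ, R4) (f ∘ φ.symm)
      (φ (φ.symm y)) :=
    hφy.symm ▸ ((hf.contDiffAt_comp_extChartAt_symm hy).differentiableAt
      (by simp)).mdifferentiableAt
  have hf' : (f ∘ φ.symm) ∘ φ =ᶠ[𝓝 (φ.symm y)] f := by
    filter_upwards [(isOpen_extChartAt_source x).mem_nhds hys] with z hz
    exact congrArg f (φ.left_inv hz)
  have hchain := mfderiv_comp (φ.symm y) hF
    (mdifferentiableAt_extChartAt (by simpa only [φ, extChartAt_source] using hys))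
  obtain ⟨A, hA⟩ := isInvertible_mfderiv_extChartAt (I := 𝓡 2) hys
  rw [hf'.mfderiv_eq, mfderiv_eq_fderiv, hφy, ← hA] at hchain
  exact ⟨A, hchain⟩

lemma isInclinedImmersionAt {P : Submodule ℝ R4} {θ : ℝ} (hf : IsImmersedSurface f)
    (hP : Module.finrank ℝ P = 2) (hangles : HasConstantPrincipalAngles f P 0 θ)
    (hy : y ∈ (extChartAt (𝓡 2) x).target) :
    IsInclinedImmersionAt P θ (f ∘ (extChartAt (𝓡 2) x).symm) y := by
  obtain ⟨A, hA⟩ := hf.exists_mfderiv_eq_fderiv_comp hy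
  have hinj : Function.Injective (fderiv ℝ (f ∘ (extChartAt (𝓡 2) x).symm) y) := by
    have hmf := hf.injective_mfderiv ((extChartAt (𝓡 2) x).symm y)
    rw [show ⇑(mfderiv (𝓡 2) 𝓘(ℝ, R4) f ((extChartAt (𝓡 2) x).symm y)) = _ ∘ A from
      congrArg DFunLike.coe hA] at hmf
    exact (A.injective_comp _).1 hmf
  have htangent : tangentPlane f ((extChartAt (𝓡 2) x).symm y) =
      LinearMap.range (fderiv ℝ (f ∘ (extChartAt (𝓡 2) x).symm) y).toLinearMap := by
    rw [tangentPlane, hA, ContinuousLinearMap.toLinearMap_comp]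
    exact LinearMap.range_comp_of_range_eq_top _ A.toLinearEquiv.range
  refine ⟨hf.contDiffAt_comp_extChartAt_symm hy, hinj, ?_⟩
  exact (htangent ▸ hangles _).exists_isPrincipalBasis
    ((LinearMap.finrank_range_of_inj hinj).trans (by simp)) hP

lemma isHolonomyTubularAt {P : Submodule ℝ R4} {θ : ℝ} (hf : IsImmersedSurface f)
    (hP : Module.finrank ℝ P = 2) (hangles : HasConstantPrincipalAngles f P 0 θ) (x : M) :
    IsHolonomyTubularAt P θ f x := by
  refine .of_comp_symm (chartAt (EuclideanSpace ℝ (Fin 2)) x) (mem_chart_source _ x) ?_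
  refine IsInclinedImmersionAt.isHolonomyTubularAt (by simp) hP (hangles x).le
    (hangles x).le_pi_div_two ?_
  filter_upwards [(chartAt (EuclideanSpace ℝ (Fin 2)) x).open_target.mem_nhds
    (mem_chart_target _ x)] with y hy
  simpa using hf.isInclinedImmersionAt (x := x) hP hangles (by simpa using hy)

end IsImmersedSurface

end ImmersedSurfaces

theorem mainTheorem6 {M : Type*} [TopologicalSpace M]
    [ChartedSpace (EuclideanSpace ℝ (Fin 2)) M] [IsManifold (𝓡 2) ∞ M]
    (f : M → R4) (hf : IsImmersedSurface f)
    (P : Submodule ℝ R4) (hP : Module.finrank ℝ P = 2)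
    (θ₂ : ℝ) (hangles : HasConstantPrincipalAngles f P 0 θ₂) :
    ∃ φ : R4 ≃ᵃⁱ[ℝ] R4, φ.linearIsometryEquiv = LinearIsometryEquiv.refl ℝ R4 ∧
      ∀ x : M, ∀ W ∈ 𝓝 x, ∃ U : Set M, U ⊆ W ∧ IsOpen U ∧ x ∈ U ∧
        IsUnionOfHolonomyTubes P θ₂ (φ '' (f '' U)) := by
  refine ⟨AffineIsometryEquiv.refl ℝ R4, rfl, fun x W hW ↦ ?_⟩
  have hθ : θ₂ ≤ Real.pi := (hangles x).le_pi_div_two.trans (half_le_self Real.pi_pos.le)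
  simpa only [AffineIsometryEquiv.coe_refl, image_id] using
    (hf.isHolonomyTubularAt hP hangles x).exists_isUnionOfHolonomyTubes hP (hangles x).le hθ hW
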